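/- **Setting.** Let $\mathcal N=(\mathcal V,\mathcal E,C)$ be a finite directed acyclic multigraph with node set $\mathcal V=\{0,1,\dots,n\}$, $n\ge 1$, numbered in a topological order, with link capacities $C_e>0$, where $0$ is the only node without incoming links (origin) and $n$ the only node without outgoing links (destination). Write $\sigma_e,\tau_e$ for the tail and head of a link $e$, and $\mathcal E_v^+,\mathcal E_v^-$ for the links leaving and entering $v$. Assume that $\mathcal N$ is a *tree*: the undirected multigraph underlying $(\mathcal V\setminus\{n\},\mathcal E\setminus\mathcal E_n^-)$ is a tree. Assume also that $\mathcal N$ is *symmetric*: after giving every link into $n$ its own copy of $n$ as a leaf, one gets a weighted rooted tree in which, recursively, the links leaving the root have equal weights and the subtrees rooted at its children are symmetric and identical to each other. Let $\lambda>0$ be the constant inflow at the origin. **Dynamics.** A routing policy assigns to $v\ne n$, $\emptyset\ne\mathcal J\subseteq\mathcal E_v^+$ and $\mu\ge0$ a vector $G^v(\mathcal J,\mu)\in\mathbb R_+^{\mathcal J}$ with $\sum_{e\in\mathcal J}G^v_e(\mathcal J,\mu)=\mu$; it is *distributed* if also $G^v_e(\mathcal J,\mu)\le G^v_e(\mathcal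 K,\mu)$ whenever $e\in\mathcal K\subseteq\mathcal J$. A disturbance process is a sequence $\delta(1),\delta(2),\ldots\in\mathbb R_+^{\mathcal E}$ with $\sum_{s\le t}\delta(s)\le C$ for all $t$; its magnitude is $\mathcal D(\delta)=\sum_{e}\sum_{t\ge1}\delta_e(t)$. Let $\mathcal E_v^{\pm}(t)=\mathcal E_v^{\pm}\cap\mathcal E(t)$ and let $\lambda_v(t)=\lambda\mathbf 1_{v=0}+\sum_{e\in\mathcal E_v^-(t)}f_e(t)$. Start with $\mathcal V(0)=\mathcal V\setminus\{n\}$, $\mathcal E(0)=\mathcal E$, $C(0)=C$ and the flow $f(0)$ determined by $f_e(0)=G^{\sigma_e}_e(\mathcal E^+_{\sigma_e},\lambda_{\sigma_e}(0))$, and for $t\ge 0$ put $$\mathcal E(t+1)=\{e\in\mathcal E(t): f_e(t)<C_e(t),\ \tau_e\in\mathcal V(t)\cup\{n\}\},\qquad \mathcal V(t+1)=\{v\in\mathcal V(t):\mathcal E_v^+(t)\neq\emptyset\},$$ $$f_e(t+1)=G_e^{v}(\mathcal E_{v}^+(t),\lambda_{v}(t))\ \ (e\in\mathcal E_v^+(t)),\qquad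 f_e(t+1)=0\ \ (e\notin\mathcal E(t)),\qquad C(t+1)=C(t)-\delta(t+1).$$ The dynamics is *transferring* if $\lim_{t\to\infty}\sum_{e\in\mathcal E_n^-}f_e(t)=\lambda$. The margin of resilience $\mathcal R(\mathcal N,\lambda,\mathcal G)$ is the infimum of $\mathcal D(\delta)$ over the disturbance processes for which it is not transferring. **Backward Propagation Algorithm.** For $\mathcal J\subseteq\mathcal E_v^+$ let $\mathcal X_v(\mathcal J,r,\mu)=\{x\in\mathbb R_+^{\mathcal J}: r_e\le x_e\le C_e\ (e\in\mathcal J),\ \sum_{e\in\mathcal J} x_e=\mu\}$. Define $S(\mathcal E_n^+,r,\mu)=+\infty$ and, for $v=n-1,\dots,0$, $S(\emptyset,r,\mu)=0$, $S(\mathcal J,r,\mu)=0$ if $\mathcal X_v(\mathcal J,r,\mu)=\emptyset$, and otherwise $$S(\mathcal J,r,\mu)=\sup_{x\in\mathcal X_v(\mathcal J,r,\mu)}\min_{e\in\mathcal J}\bigl(S_e(x_e)+S(\mathcal J\setminus\{e\},x,\mu)\bigr),\qquad S_e(\mu)=\min\{[C_e-\mu]^+,S(\mathcal E_{\tau_e}^+,\mathbf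 0,\mu)\}.$$ Let $g(\mathcal J,r,\mu)$ be the set of maximizers and $S^*(\mathcal N,\lambda)=S(\mathcal E_0^+,\mathbf 0,\lambda)$. A routing policy is a *BPA routing* if for all $v\ne n$, $\mu\ge0$ one has $r^*:=G^v(\mathcal E_v^+,\mu)\in g(\mathcal E_v^+,\mathbf 0,\mu)$ and $G^v(\mathcal J,\mu)\in g(\mathcal J,r^*,\mu)$ for all $\emptyset\ne\mathcal J\subsetneq\mathcal E_v^+$, each requirement being imposed only where the corresponding set $\mathcal X_v$ is non-empty. **Proposition.** Under BPA routing on a symmetric tree $\mathcal N$ with constant inflow $\lambda>0$ at the origin, the dynamics is transferring for every disturbance process $\delta$ with $\mathcal D(\delta)<S^*(\mathcal N,\lambda)$. Consequently BPA routing is maximally resilient: $\mathcal R(\mathcal N,\lambda,\mathcal G)=\sup_{\mathcal G'}\mathcal R(\mathcal N,\lambda,\mathcal G')$, the supremum being over all distributed routing policies $\mathcal G'$. -/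

import Mathlib

open Filter Topology
open scoped ENNReal

/-- A finite directed multigraph with link set `E`, node set `{0, …, n}`, and strictly positive link
capacities. Node `0` is the only origin (node without incoming links), node `n` is the only
destination (node without outgoing links), and they are distinct. The graph is acyclic and the nodes
are numbered in a topological order. -/
structure FlowNetwork (n : ℕ) (E : Type*) where
  tail : E → Fin (n + 1)
  head : E → Fin (n + 1)
  cap : E → ℝ
  cap_pos : ∀ e, 0 < cap e
  n_pos : 0 < n
  tail_lt_head : ∀ e, tail e < head e
  exists_in : ∀ v, v ≠ 0 → ∃ e, head e = v
  exists_out : ∀ v, v ≠ Fin.last n → ∃ e, tail e = v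

/-- A policy: `G v J μ e` is the flow that node `v` sends on link `e` when its set of active outgoing
links is `J` and its inflow is `μ`. -/
abbrev RoutingMap (n : ℕ) (E : Type*) : Type _ := Fin (n + 1) → Finset E → ℝ → E → ℝ

/-- State of the flow dynamics: active non-destination nodes, active links, link flows and residual
capacities. -/
structure FlowState (n : ℕ) (E : Type*) where
  nodes : Finset (Fin (n + 1))
  links : Finset E
  flow : E → ℝ
  rescap : E → ℝ

/-- Vectors `x ∈ ℝ₊^J` (extended by zero outside `J`) with `r ≤ x ≤ C` on `J` and total mass `μ`. -/
def feasibleSplits {E : Type*} (C : E → ℝ) (J : Finset E) (r : E → ℝ) (μ : ℝ) : Set (E → ℝ) :=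
  {x | (∀ e ∈ J, 0 ≤ x e ∧ r e ≤ x e ∧ x e ≤ C e) ∧ (∀ e, e ∉ J → x e = 0) ∧ ∑ e ∈ J, x e = μ}

/-- Total capacity removed by the disturbance `δ(1), δ(2), …`. -/
noncomputable def disturbanceMagnitude {E : Type*} [Fintype E] (δ : ℕ → E → ℝ) : ℝ≥0∞ :=
  ∑ e, ∑' t : ℕ, ENNReal.ofReal (δ (t + 1) e)

namespace FlowNetwork

section Topology

variable {n : ℕ} {E : Type*} (N : FlowNetwork n E)

/-- The simple graph underlying the network with the destination and its incoming links removed. -/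
def underlyingGraph : SimpleGraph {v : Fin (n + 1) // v ≠ Fin.last n} :=
  SimpleGraph.fromRel (fun u w => ∃ e, N.tail e = u.1 ∧ N.head e = w.1)

/-- The multigraph left after removing the destination and its incoming links is a directed tree: its
underlying undirected multigraph is a tree, so in particular there are no parallel links in it. -/
def IsDirectedTree : Prop :=
  N.underlyingGraph.IsTree ∧
    ∀ e e', N.head e ≠ Fin.last n → N.tail e = N.tail e' → N.head e = N.head e' → e = e'

/-- The weighted rooted trees hanging from two nodes are identical (isomorphic with the same link
weights). Every link into the destination ends in a leaf of its own. -/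
inductive SameSubtree : Fin (n + 1) → Fin (n + 1) → Prop
  | leaf : SameSubtree (Fin.last n) (Fin.last n)
  | node (u w : Fin (n + 1)) (hu : u ≠ Fin.last n) (hw : w ≠ Fin.last n)
      (φ : {e : E // N.tail e = u} ≃ {e : E // N.tail e = w})
      (hcap : ∀ e, N.cap (φ e).1 = N.cap e.1)
      (hsub : ∀ e, SameSubtree (N.head e.1) (N.head (φ e).1)) : SameSubtree u w

/-- The weighted rooted tree hanging from a node is symmetric: the links leaving the root have equal
weights, and the subtrees rooted at the children are symmetric and identical to each other. -/
inductive SymmetricAt : Fin (n + 1) → Prop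
  | leaf : SymmetricAt (Fin.last n)
  | node (v : Fin (n + 1)) (hv : v ≠ Fin.last n)
      (hcap : ∀ e e', N.tail e = v → N.tail e' = v → N.cap e = N.cap e')
      (hsub : ∀ e, N.tail e = v → SymmetricAt (N.head e))
      (hsame : ∀ e e', N.tail e = v → N.tail e' = v → N.SameSubtree (N.head e) (N.head e')) :
      SymmetricAt v

/-- The network is symmetric. -/
def IsSymmetric : Prop := N.SymmetricAt 0

/-- Disturbance processes `δ(1), δ(2), …`: nonnegative capacity reductions that never remove more than
the capacity of a link. -/
def IsDisturbance (δ : ℕ → E → ℝ) : Prop :=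
  (∀ t e, 0 ≤ δ (t + 1) e) ∧ ∀ t e, ∑ s ∈ Finset.range t, δ (s + 1) e ≤ N.cap e

end Topology

section Dynamics

variable {n : ℕ} {E : Type*} [Fintype E] [DecidableEq E] (N : FlowNetwork n E)

/-- Outgoing links of `v`. -/
def outLinks (v : Fin (n + 1)) : Finset E := Finset.univ.filter (fun e => N.tail e = v)

/-- Incoming links of `v`. -/
def inLinks (v : Fin (n + 1)) : Finset E := Finset.univ.filter (fun e => N.head e = v)

/-- `G` splits every inflow among the active outgoing links. -/
def IsRoutingPolicy (G : RoutingMap n E) : Prop :=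
  ∀ v, v ≠ Fin.last n → ∀ J : Finset E, J ⊆ N.outLinks v → J.Nonempty → ∀ μ : ℝ, 0 ≤ μ →
    (∀ e, 0 ≤ G v J μ e) ∧ (∀ e, e ∉ J → G v J μ e = 0) ∧ ∑ e ∈ J, G v J μ e = μ

/-- Distributed oblivious routing policies: routing policies with the link monotonicity property. -/
def IsDistributedPolicy (G : RoutingMap n E) : Prop :=
  N.IsRoutingPolicy G ∧
    ∀ v, v ≠ Fin.last n → ∀ J K : Finset E, J ⊆ N.outLinks v → K ⊆ J → K.Nonempty →
      ∀ μ : ℝ, 0 ≤ μ → ∀ e ∈ K, G v J μ e ≤ G v K μ e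

/-- Inflow at the nodes for the initial flow, when all links are active and every node routes its
inflow by `G`. -/
noncomputable def initialInflow (lam : ℝ) (G : RoutingMap n E) (v : Fin (n + 1)) : ℝ :=
  (if v = 0 then lam else 0) +
    ∑ e : {e : E // N.head e = v},
      G (N.tail e.1) (N.outLinks (N.tail e.1)) (initialInflow lam G (N.tail e.1)) e.1
termination_by v.val
decreasing_by
  have h := N.tail_lt_head e.1
  rw [e.2] at h
  exact h

/-- The initial state: everything is active, nothing is removed, and the flow is the one that the
policy induces from the external inflow `lam` at the origin. -/
noncomputable def initialState (lam : ℝ) (G : RoutingMap n E) : FlowState n E where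
  nodes := Finset.univ.erase (Fin.last n)
  links := Finset.univ
  flow := fun e => G (N.tail e) (N.outLinks (N.tail e)) (N.initialInflow lam G (N.tail e)) e
  rescap := N.cap

/-- Active outgoing links of `v`. -/
def activeOut (s : FlowState n E) (v : Fin (n + 1)) : Finset E := N.outLinks v ∩ s.links

/-- Current inflow of `v`: the external inflow plus the flow on the active incoming links. -/
noncomputable def inflow (lam : ℝ) (s : FlowState n E) (v : Fin (n + 1)) : ℝ :=
  (if v = 0 then lam else 0) + ∑ e ∈ N.inLinks v ∩ s.links, s.flow e

open Classical in
/-- One step of the dynamics, where `d` is the capacity reduction applied in it. A link becomes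
inactive when it is overloaded or its head is an inactive node (the destination never is one), a node
becomes inactive when it has no active outgoing link. Inactive links carry no flow. -/
noncomputable def step (lam : ℝ) (G : RoutingMap n E) (d : E → ℝ) (s : FlowState n E) :
    FlowState n E where
  nodes := s.nodes.filter (fun v => (N.activeOut s v).Nonempty)
  links := s.links.filter
    (fun e => s.flow e < s.rescap e ∧ (N.head e = Fin.last n ∨ N.head e ∈ s.nodes))
  flow := fun e =>
    if e ∈ s.links then G (N.tail e) (N.activeOut s (N.tail e)) (N.inflow lam s (N.tail e)) e else 0
  rescap := fun e => s.rescap e - d e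

/-- The state at time `t` under the disturbance process `δ`. -/
noncomputable def state (lam : ℝ) (G : RoutingMap n E) (δ : ℕ → E → ℝ) : ℕ → FlowState n E
  | 0 => N.initialState lam G
  | t + 1 => N.step lam G (δ (t + 1)) (state lam G δ t)

/-- The flow that reaches the destination converges to the external inflow. -/
def IsTransferring (lam : ℝ) (G : RoutingMap n E) (δ : ℕ → E → ℝ) : Prop :=
  Tendsto (fun t => ∑ e ∈ N.inLinks (Fin.last n), (N.state lam G δ t).flow e) atTop (𝓝 lam)

/-- Margin of resilience of the network under the policy `G`. -/
noncomputable def resilience (lam : ℝ) (G : RoutingMap n E) : ℝ≥0∞ :=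
  ⨅ (δ : ℕ → E → ℝ) (_ : N.IsDisturbance δ) (_ : ¬ N.IsTransferring lam G δ),
    disturbanceMagnitude δ

/-- The largest margin of resilience among all distributed routing policies. -/
noncomputable def maxResilience (lam : ℝ) : ℝ≥0∞ :=
  ⨆ (G : RoutingMap n E) (_ : N.IsDistributedPolicy G), N.resilience lam G

open Classical in
/-- The functions `S(J, r, μ)`, `J ⊆ E_v⁺`, of the Backward Propagation Algorithm. For `J = {e}` with
a feasible split the maximum has only the candidate `x e = μ`, so the recursion gives the value
`min {C e - μ, S(E_{head e}⁺, 0, μ)}`. The restriction `N.tail e = v` is automatic for `J ⊆ E_v⁺`. -/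
noncomputable def bpaValue (v : Fin (n + 1)) (J : Finset E) (r : E → ℝ) (μ : ℝ) : ℝ≥0∞ :=
  if v = Fin.last n then ⊤
  else if J = ∅ ∨ ¬ (feasibleSplits N.cap J r μ).Nonempty then 0
  else ⨆ x ∈ feasibleSplits N.cap J r μ, ⨅ (e : E) (_ : e ∈ J ∧ N.tail e = v),
    (min (ENNReal.ofReal (N.cap e - x e)) (bpaValue (N.head e) (N.outLinks (N.head e)) 0 (x e))
      + bpaValue v (J.erase e) x μ)
termination_by (n - v.val, J.card)
decreasing_by
  · rename_i h
    have h1 : v.val < (N.head e).val := h.2 ▸ N.tail_lt_head e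
    have := (N.head e).isLt
    exact Prod.Lex.left _ _ (by omega)
  · rename_i h
    exact Prod.Lex.right _ (Finset.card_erase_lt_of_mem h.1)

/-- `S_e(μ)`: the smaller of the spare capacity of `e` and the value of its head node. -/
noncomputable def linkValue (e : E) (μ : ℝ) : ℝ≥0∞ :=
  min (ENNReal.ofReal (N.cap e - μ)) (N.bpaValue (N.head e) (N.outLinks (N.head e)) 0 μ)

/-- The quantity that is maximized over `x` in the Backward Propagation Algorithm. -/
noncomputable def bpaObjective (v : Fin (n + 1)) (J : Finset E) (μ : ℝ) (x : E → ℝ) : ℝ≥0∞ :=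
  ⨅ e ∈ J, (N.linkValue e (x e) + N.bpaValue v (J.erase e) x μ)

theorem bpaValue_eq {v : Fin (n + 1)} (hv : v ≠ Fin.last n) {J : Finset E}
    (hJ : J ⊆ N.outLinks v) (hne : J.Nonempty) (r : E → ℝ) (μ : ℝ) :
    N.bpaValue v J r μ = ⨆ x ∈ feasibleSplits N.cap J r μ, N.bpaObjective v J μ x := by
  have key : ∀ e, (e ∈ J ∧ N.tail e = v) ↔ e ∈ J := fun e =>
    ⟨fun h => h.1, fun h => ⟨h, (Finset.mem_filter.1 (hJ h)).2⟩⟩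
  rw [bpaValue, if_neg hv]
  by_cases hX : (feasibleSplits N.cap J r μ).Nonempty
  · rw [if_neg (by simp [hne.ne_empty, hX])]
    simp only [bpaObjective, linkValue, key]
  · rw [if_pos (Or.inr hX), Set.not_nonempty_iff_eq_empty.1 hX]
    simp

/-- The set `g(J, r, μ)` of maximizers. -/
def bpaArgmax (v : Fin (n + 1)) (J : Finset E) (r : E → ℝ) (μ : ℝ) : Set (E → ℝ) :=
  {x | x ∈ feasibleSplits N.cap J r μ ∧
    ∀ y ∈ feasibleSplits N.cap J r μ, N.bpaObjective v J μ y ≤ N.bpaObjective v J μ x}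

/-- BPA routing: with all links active the policy takes a maximizer without lower bound, `r*`; with a
proper subset of them active it takes a maximizer above `r*`. The requirement is void where there is
no feasible split at all, e.g. when the inflow exceeds the capacity of the active links. -/
def IsBPARouting (G : RoutingMap n E) : Prop :=
  ∀ v, v ≠ Fin.last n → ∀ μ : ℝ, 0 ≤ μ →
    ((feasibleSplits N.cap (N.outLinks v) 0 μ).Nonempty →
      G v (N.outLinks v) μ ∈ N.bpaArgmax v (N.outLinks v) 0 μ) ∧
    ∀ J : Finset E, J ⊂ N.outLinks v → J.Nonempty →
      (feasibleSplits N.cap J (G v (N.outLinks v) μ) μ).Nonempty →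
      G v J μ ∈ N.bpaArgmax v J (G v (N.outLinks v) μ) μ

/-- The output `S*(N, lam)` of the Backward Propagation Algorithm. -/
noncomputable def bpaBound (lam : ℝ) : ℝ≥0∞ := N.bpaValue 0 (N.outLinks 0) 0 lam

end Dynamics

end FlowNetwork

/-! On a symmetric network all links leaving a node have the same value `f` as a function of their
flow, and `f` strictly decreases until it reaches zero. When the links of a node fail one after the
other, some link carries at least the even share `μ / j` while `j` of them are left. Every split is
therefore worth at most `∑ j, f (μ / j)`, and the even split attains this sum. Hence a maximizer is
even wherever the even split gives the links a positive value.

Under such a policy a node whose inflow has never exceeded `μ` fails only after capacity worth its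
value at `μ` has been removed from the tree below it, because a link that fails has lost either its
spare capacity or its head. At the origin this gives transfer below the bound.

Conversely, against every policy the attacker descends from the origin along links that carry at
least the even share, down to a link whose value is its spare capacity, and removes that capacity.
The path accounts for the cost of finishing off every node on it, and once the dynamics has settled
again a new path costs no more than what remains of that sum. Repeating this until the origin has
failed costs at most the bound. -/

theorem eventuallyConst_pi {ι α β : Type*} [Finite ι] [Nonempty β] {l : Filter α}
    {f : α → ι → β} (h : ∀ i, EventuallyConst (fun a => f a i) l) : EventuallyConst f l := by
  choose c hc using fun i => eventuallyConst_iff_exists_eventuallyEq.1 (h i)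
  exact eventuallyConst_iff_exists_eventuallyEq.2
    ⟨c, (eventually_all.2 hc).mono fun _ ha => funext ha⟩

theorem eventuallyConst_of_antitone {α : Type*} [PartialOrder α] [WellFoundedLT α] {u : ℕ → α}
    (hu : Antitone u) : EventuallyConst u atTop := by
  obtain ⟨T, hT⟩ := WellFoundedLT.antitone_chain_condition hu
  exact eventuallyConst_atTop.2 ⟨T, fun t ht => (hT t ht).symm⟩

theorem div_card_le_div_card {E : Type*} {J K : Finset E} {μ : ℝ} (hμ : 0 ≤ μ) (hKJ : K ⊆ J)
    (hK : K.Nonempty) : μ / J.card ≤ μ / K.card :=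
  div_le_div_of_nonneg_left hμ (by exact_mod_cast hK.card_pos)
    (by exact_mod_cast Finset.card_le_card hKJ)

theorem exists_div_card_le_of_sum_eq {E : Type*} {J : Finset E} (hJ : J.Nonempty) {x : E → ℝ}
    {μ : ℝ} (hx : ∑ e ∈ J, x e = μ) : ∃ e ∈ J, μ / J.card ≤ x e := by
  refine Finset.exists_le_of_sum_le hJ ?_
  have hJ₀ : (J.card : ℝ) ≠ 0 := by exact_mod_cast hJ.card_ne_zero
  rw [hx, Finset.sum_const, nsmul_eq_mul, mul_div_cancel₀ _ hJ₀]

/-- The split of `μ` into equal parts on the members of `J`. -/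
noncomputable def evenSplit {E : Type*} [DecidableEq E] (J : Finset E) (μ : ℝ) (e : E) : ℝ :=
  if e ∈ J then μ / J.card else 0

section EvenSplit

variable {E : Type*} [DecidableEq E] {J : Finset E} {μ : ℝ}

theorem evenSplit_of_mem {e : E} (he : e ∈ J) : evenSplit J μ e = μ / J.card := if_pos he

theorem evenSplit_of_notMem {e : E} (he : e ∉ J) : evenSplit J μ e = 0 := if_neg he

theorem evenSplit_nonneg (hμ : 0 ≤ μ) (e : E) : 0 ≤ evenSplit J μ e := by
  unfold evenSplit
  split_ifs <;> positivity

theorem sum_evenSplit (hJ : J.Nonempty) : ∑ e ∈ J, evenSplit J μ e = μ := by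
  have hJ₀ : (J.card : ℝ) ≠ 0 := by exact_mod_cast hJ.card_ne_zero
  rw [Finset.sum_congr rfl fun _ => evenSplit_of_mem, Finset.sum_const, nsmul_eq_mul,
    mul_div_cancel₀ _ hJ₀]

theorem evenSplit_mem_feasibleSplits {C r : E → ℝ} (hJ : J.Nonempty) (hμ : 0 ≤ μ)
    (hr : ∀ e ∈ J, r e ≤ μ / J.card) (hC : ∀ e ∈ J, μ / J.card ≤ C e) :
    evenSplit J μ ∈ feasibleSplits C J r μ := by
  refine ⟨fun e he => ?_, fun e => evenSplit_of_notMem, sum_evenSplit hJ⟩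
  rw [evenSplit_of_mem he]
  exact ⟨by positivity, hr e he, hC e he⟩

end EvenSplit

/-- On `[0, ∞)` the function strictly decreases as long as it is positive; once it reaches zero it
stays there. This is the shape of the values computed by the Backward Propagation Algorithm. -/
def StrictAntiUntilZero (f : ℝ → ℝ≥0∞) : Prop :=
  ∀ ⦃x y⦄, 0 ≤ x → x < y → 0 < f y → f y < f x

/-- The total of `f` along a cascade: `k` links fail one after the other while `μ` is split evenly
among those that are left, each contributing the value of `f` at its load when it fails. -/
noncomputable def cascadeSum (f : ℝ → ℝ≥0∞) (k : ℕ) (μ : ℝ) : ℝ≥0∞ :=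
  ∑ i ∈ Finset.range k, f (μ / (i + 1 : ℕ))

section CascadeSum

variable {f g : ℝ → ℝ≥0∞} {k : ℕ} {μ : ℝ}

theorem cascadeSum_zero : cascadeSum f 0 μ = 0 := Finset.sum_range_zero _

theorem cascadeSum_succ (f : ℝ → ℝ≥0∞) (k : ℕ) (μ : ℝ) :
    cascadeSum f (k + 1) μ = cascadeSum f k μ + f (μ / (k + 1 : ℕ)) :=
  Finset.sum_range_succ _ _

theorem cascadeSum_mono (f : ℝ → ℝ≥0∞) (μ : ℝ) : Monotone fun k => cascadeSum f k μ :=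
  fun _ _ h => Finset.sum_le_sum_of_subset (Finset.range_subset_range.2 h)

theorem cascadeSum_ne_top (hf : ∀ x, f x ≠ ⊤) : cascadeSum f k μ ≠ ⊤ :=
  ENNReal.sum_ne_top.2 fun _ _ => hf _

theorem cascadeSum_congr (hfg : Set.EqOn f g (Set.Ici 0)) (hμ : 0 ≤ μ) :
    cascadeSum f k μ = cascadeSum g k μ :=
  Finset.sum_congr rfl fun _ _ => hfg (Set.mem_Ici.2 (by positivity))

theorem cascadeSum_eq_zero (hf : AntitoneOn f (Set.Ici 0)) (hμ : 0 ≤ μ) (h : f (μ / k) = 0) :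
    cascadeSum f k μ = 0 := by
  refine Finset.sum_eq_zero fun i hi => le_bot_iff.1 ?_
  have hik : i + 1 ≤ k := Finset.mem_range.1 hi
  calc f (μ / (i + 1 : ℕ))
      ≤ f (μ / k) := hf (Set.mem_Ici.2 (by positivity)) (Set.mem_Ici.2 (by positivity)) (by gcongr)
    _ = ⊥ := h

theorem cascadeSum_card_erase_add {E : Type*} [DecidableEq E] {J : Finset E} {e : E} (he : e ∈ J) :
    cascadeSum f (J.erase e).card μ + f (μ / J.card) = cascadeSum f J.card μ := by
  rw [← Finset.card_erase_add_one he, cascadeSum_succ]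

theorem cascadeSum_card_le_sum_sdiff_add {E : Type*} [DecidableEq E]
    (hf : AntitoneOn f (Set.Ici 0)) (hμ : 0 ≤ μ) {w : E → ℝ≥0∞} {J K : Finset E} (hKJ : K ⊆ J)
    (hw : ∀ e ∈ J \ K, f (μ / J.card) ≤ w e) :
    cascadeSum f J.card μ ≤ ∑ e ∈ J \ K, w e + cascadeSum f K.card μ := by
  induction J using Finset.strongInduction with
  | H J ih =>
    rcases hKJ.eq_or_ssubset with rfl | hss
    · simp
    obtain ⟨e, heJ, heK⟩ := Finset.exists_of_ssubset hss
    have herase : (J \ K).erase e = J.erase e \ K := by grind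
    rw [← cascadeSum_card_erase_add heJ,
      ← Finset.sum_erase_add _ _ (Finset.mem_sdiff.2 ⟨heJ, heK⟩), add_right_comm, herase]
    gcongr
    · refine ih _ (Finset.erase_ssubset heJ) (by grind) fun e' he' => ?_
      refine (hf (Set.mem_Ici.2 (by positivity)) (Set.mem_Ici.2 (by positivity)) ?_).trans
        (hw e' (by grind))
      exact div_card_le_div_card hμ (J.erase_subset e) ⟨e', (Finset.mem_sdiff.1 he').1⟩
    · exact hw e (Finset.mem_sdiff.2 ⟨heJ, heK⟩)

theorem cascadeSum_card_le_sum_of_antitone {E : Type*} [DecidableEq E]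
    (hf : AntitoneOn f (Set.Ici 0)) (hμ : 0 ≤ μ) {w : E → ℝ≥0∞} {A : ℕ → Finset E}
    (hA : Antitone A) {T : ℕ}
    (hw : ∀ t < T, ∀ e ∈ A t \ A (t + 1), f (μ / (A t).card) ≤ w e) :
    cascadeSum f (A 0).card μ ≤ ∑ e ∈ A 0 \ A T, w e + cascadeSum f (A T).card μ := by
  induction T with
  | zero => simp
  | succ T ih =>
    have hsdiff : A 0 \ A (T + 1) = (A 0 \ A T) ∪ (A T \ A (T + 1)) := by
      have h₁ := hA T.zero_le
      have h₂ := hA T.le_succ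
      grind
    have hdisj : Disjoint (A 0 \ A T) (A T \ A (T + 1)) :=
      Finset.sdiff_disjoint.mono_right Finset.sdiff_subset
    rw [hsdiff, Finset.sum_union hdisj, add_assoc]
    refine (ih fun t ht => hw t (ht.trans T.lt_succ_self)).trans ?_
    gcongr
    exact cascadeSum_card_le_sum_sdiff_add hf hμ (hA T.le_succ) (hw T T.lt_succ_self)

end CascadeSum

theorem strictAntiUntilZero_ofReal_sub (c : ℝ) :
    StrictAntiUntilZero fun x => ENNReal.ofReal (c - x) := fun x y _ hxy hpos =>
  (ENNReal.ofReal_lt_ofReal_iff_of_nonneg (ENNReal.ofReal_pos.1 hpos).le).2 (by linarith)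

namespace StrictAntiUntilZero

variable {f g : ℝ → ℝ≥0∞}

theorem antitoneOn (hf : StrictAntiUntilZero f) : AntitoneOn f (Set.Ici 0) := by
  intro x hx y _ hxy
  rcases hxy.eq_or_lt with rfl | hlt
  · exact le_rfl
  rcases eq_zero_or_pos (f y) with h0 | hpos
  · exact h0 ▸ zero_le
  · exact (hf hx hlt hpos).le

theorem le_of_le (hf : StrictAntiUntilZero f) {x y : ℝ} (hx : 0 ≤ x) (hpos : 0 < f x)
    (hxy : f x ≤ f y) : y ≤ x := by
  by_contra! hlt
  exact (hf hx hlt (hpos.trans_le hxy)).not_ge hxy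

theorem min (hf : StrictAntiUntilZero f) (hg : StrictAntiUntilZero g) :
    StrictAntiUntilZero fun x => Min.min (f x) (g x) := by
  intro x y hx hxy hpos
  obtain ⟨hf₀, hg₀⟩ := lt_min_iff.1 hpos
  exact min_lt_min (hf hx hxy hf₀) (hg hx hxy hg₀)

theorem congr (hf : StrictAntiUntilZero f) (hfg : Set.EqOn f g (Set.Ici 0)) :
    StrictAntiUntilZero g := by
  intro x y hx hxy hpos
  rw [← hfg (Set.mem_Ici.2 hx), ← hfg (Set.mem_Ici.2 (hx.trans hxy.le))] at *
  exact hf hx hxy hpos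

theorem cascadeSum (hf : StrictAntiUntilZero f) (hf' : ∀ x, f x ≠ ⊤) {k : ℕ} (hk : k ≠ 0) :
    StrictAntiUntilZero (cascadeSum f k) := by
  intro x y hx hxy hpos
  have hy : 0 ≤ y := hx.trans hxy.le
  have hlast : 0 < f (y / k) :=
    pos_of_ne_zero fun h => hpos.ne' (cascadeSum_eq_zero hf.antitoneOn hy h)
  obtain ⟨k, rfl⟩ := Nat.exists_eq_succ_of_ne_zero hk
  rw [Nat.succ_eq_add_one, cascadeSum_succ, cascadeSum_succ]
  refine ENNReal.add_lt_add_of_le_of_lt (cascadeSum_ne_top hf') ?_ ?_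
  · exact Finset.sum_le_sum fun i _ => hf.antitoneOn (Set.mem_Ici.2 (by positivity))
      (Set.mem_Ici.2 (by positivity)) (by gcongr)
  · exact hf (by positivity) (by gcongr) hlast

end StrictAntiUntilZero

namespace FlowNetwork

section Basic

variable {n : ℕ} {E : Type*} {N : FlowNetwork n E}

theorem tail_ne_last (N : FlowNetwork n E) (e : E) : N.tail e ≠ Fin.last n :=
  ((N.tail_lt_head e).trans_le (Fin.le_last _)).ne

theorem head_ne_zero (N : FlowNetwork n E) (e : E) : N.head e ≠ 0 :=
  ((Fin.zero_le _).trans_lt (N.tail_lt_head e)).ne'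

theorem zero_ne_last (N : FlowNetwork n E) : (0 : Fin (n + 1)) ≠ Fin.last n :=
  fun h => N.n_pos.ne (congrArg Fin.val h)

theorem SymmetricAt.head {e : E} (h : N.SymmetricAt (N.tail e)) : N.SymmetricAt (N.head e) := by
  generalize hv : N.tail e = v at h
  cases h with
  | leaf => exact absurd hv (N.tail_ne_last e)
  | node _ _ _ hsub _ => exact hsub e hv

theorem IsSymmetric.symmetricAt (hSymm : N.IsSymmetric) (v : Fin (n + 1)) : N.SymmetricAt v := by
  induction v using WellFoundedLT.induction with
  | ind v ih =>
    by_cases h0 : v = 0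
    · exact h0 ▸ hSymm
    · obtain ⟨e, rfl⟩ := N.exists_in v h0
      exact (ih _ (N.tail_lt_head e)).head

variable [Fintype E]

@[simp]
theorem mem_outLinks {v : Fin (n + 1)} {e : E} : e ∈ N.outLinks v ↔ N.tail e = v := by
  simp [outLinks]

@[simp]
theorem mem_inLinks {v : Fin (n + 1)} {e : E} : e ∈ N.inLinks v ↔ N.head e = v := by
  simp [inLinks]

theorem outLinks_nonempty {v : Fin (n + 1)} (hv : v ≠ Fin.last n) : (N.outLinks v).Nonempty := by
  obtain ⟨e, he⟩ := N.exists_out v hv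
  exact ⟨e, mem_outLinks.2 he⟩

theorem outLinks_last : N.outLinks (Fin.last n) = ∅ :=
  Finset.eq_empty_of_forall_notMem fun e he => N.tail_ne_last e (mem_outLinks.1 he)

theorem ne_last_of_subset_outLinks {v : Fin (n + 1)} {J : Finset E} (hJ : J ⊆ N.outLinks v)
    (hne : J.Nonempty) : v ≠ Fin.last n := by
  rintro rfl
  exact hne.ne_empty (Finset.subset_empty.1 (outLinks_last (N := N) ▸ hJ))

end Basic

section Values

variable {n : ℕ} {E : Type*} [Fintype E] [DecidableEq E]

/-- The value `S(E_v⁺, 0, μ)` of a node with inflow `μ` whose outgoing links are all active. -/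
noncomputable def nodeValue (N : FlowNetwork n E) (v : Fin (n + 1)) (μ : ℝ) : ℝ≥0∞ :=
  N.bpaValue v (N.outLinks v) 0 μ

/-- All links leaving `v` have the same value on nonnegative flows. -/
def IsUniformAt (N : FlowNetwork n E) (v : Fin (n + 1)) : Prop :=
  ∀ ⦃e e'⦄, N.tail e = v → N.tail e' = v →
    Set.EqOn (N.linkValue e) (N.linkValue e') (Set.Ici 0)

/-- The common value of the links leaving `v` where `N.IsUniformAt v` holds, encoded as a supremum
so that it is defined at every node. -/
noncomputable def branchValue (N : FlowNetwork n E) (v : Fin (n + 1)) (x : ℝ) : ℝ≥0∞ :=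
  (N.outLinks v).sup fun e => N.linkValue e x

variable {N : FlowNetwork n E}

theorem linkValue_eq (e : E) :
    N.linkValue e = fun x => min (ENNReal.ofReal (N.cap e - x)) (N.nodeValue (N.head e) x) := rfl

theorem nodeValue_last (μ : ℝ) : N.nodeValue (Fin.last n) μ = ⊤ := by
  rw [nodeValue, bpaValue, if_pos rfl]

theorem linkValue_lt_top (e : E) (x : ℝ) : N.linkValue e x < ⊤ :=
  (min_le_left _ _).trans_lt ENNReal.ofReal_lt_top

theorem linkValue_le_ofReal (e : E) (x : ℝ) : N.linkValue e x ≤ ENNReal.ofReal (N.cap e - x) :=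
  min_le_left _ _

theorem lt_cap_of_linkValue_pos {e : E} {x : ℝ} (h : 0 < N.linkValue e x) : x < N.cap e :=
  sub_pos.1 (ENNReal.ofReal_pos.1 (h.trans_le (linkValue_le_ofReal e x)))

theorem branchValue_ne_top (v : Fin (n + 1)) (x : ℝ) : N.branchValue v x ≠ ⊤ :=
  ((Finset.sup_lt_iff ENNReal.zero_lt_top).2 fun e _ => linkValue_lt_top e x).ne

theorem IsUniformAt.branchValue_eq {e : E} (hU : N.IsUniformAt (N.tail e)) :
    Set.EqOn (N.branchValue (N.tail e)) (N.linkValue e) (Set.Ici 0) := fun _ hx =>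
  le_antisymm (Finset.sup_le fun _ he' => (hU (mem_outLinks.1 he') rfl hx).le)
    (Finset.le_sup (f := fun e => N.linkValue e _) (mem_outLinks.2 rfl))

theorem IsUniformAt.linkValue_eq {v : Fin (n + 1)} (hU : N.IsUniformAt v) {e : E}
    (he : N.tail e = v) {x : ℝ} (hx : 0 ≤ x) : N.linkValue e x = N.branchValue v x := by
  subst he
  exact (hU.branchValue_eq hx).symm

section Node

variable {v : Fin (n + 1)} {J : Finset E} {μ : ℝ}

theorem bpaValue_empty (hv : v ≠ Fin.last n) (r : E → ℝ) : N.bpaValue v ∅ r μ = 0 := by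
  rw [bpaValue, if_neg hv, if_pos (Or.inl rfl)]

variable (hU : N.IsUniformAt v) (hanti : AntitoneOn (N.branchValue v) (Set.Ici 0)) (hμ : 0 ≤ μ)
include hU hanti hμ

-- Some link of every split receives at least the even share, so its failure is worth no more than
-- in the even split.
theorem bpaValue_le_cascadeSum (hv : v ≠ Fin.last n) (hJ : J ⊆ N.outLinks v) (r : E → ℝ) :
    N.bpaValue v J r μ ≤ cascadeSum (N.branchValue v) J.card μ := by
  induction J using Finset.strongInduction generalizing r with
  | H J ih =>
    rcases J.eq_empty_or_nonempty with rfl | hne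
    · simp [bpaValue_empty hv]
    rw [bpaValue_eq N hv hJ hne]
    refine iSup₂_le fun x hx => ?_
    obtain ⟨e, he, hle⟩ := exists_div_card_le_of_sum_eq hne hx.2.2
    have hμJ : 0 ≤ μ / J.card := by positivity
    calc N.bpaObjective v J μ x
        ≤ N.linkValue e (x e) + N.bpaValue v (J.erase e) x μ := iInf₂_le e he
      _ = N.bpaValue v (J.erase e) x μ + N.branchValue v (x e) := by
        rw [add_comm, hU.linkValue_eq (mem_outLinks.1 (hJ he)) (hμJ.trans hle)]
      _ ≤ cascadeSum (N.branchValue v) (J.erase e).card μ + N.branchValue v (μ / J.card) :=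
        add_le_add (ih _ (Finset.erase_ssubset he) ((J.erase_subset e).trans hJ) x)
          (hanti hμJ (hμJ.trans hle) hle)
      _ = cascadeSum (N.branchValue v) J.card μ := cascadeSum_card_erase_add he

theorem cascadeSum_le_bpaValue_of_le_bpaObjective (hJ : J ⊆ N.outLinks v) (hne : J.Nonempty)
    {r : E → ℝ} (hr : ∀ e ∈ J, r e ≤ μ / J.card)
    (hobj : cascadeSum (N.branchValue v) J.card μ ≤ N.bpaObjective v J μ (evenSplit J μ)) :
    cascadeSum (N.branchValue v) J.card μ ≤ N.bpaValue v J r μ := by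
  rcases eq_zero_or_pos (N.branchValue v (μ / J.card)) with h0 | hpos
  · exact (cascadeSum_eq_zero hanti hμ h0).trans_le zero_le
  rw [bpaValue_eq N (ne_last_of_subset_outLinks hJ hne) hJ hne]
  refine le_iSup₂_of_le _ (evenSplit_mem_feasibleSplits hne hμ hr fun e he => ?_) hobj
  rw [← hU.linkValue_eq (mem_outLinks.1 (hJ he)) (by positivity)] at hpos
  exact (lt_cap_of_linkValue_pos hpos).le

theorem cascadeSum_le_bpaObjective_evenSplit (hJ : J ⊆ N.outLinks v) :
    cascadeSum (N.branchValue v) J.card μ ≤ N.bpaObjective v J μ (evenSplit J μ) := by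
  induction J using Finset.strongInduction with
  | H J ih =>
    refine le_iInf₂ fun e he => ?_
    have herase : J.erase e ⊆ N.outLinks v := (J.erase_subset e).trans hJ
    rw [evenSplit_of_mem he, hU.linkValue_eq (mem_outLinks.1 (hJ he)) (by positivity),
      ← cascadeSum_card_erase_add he, add_comm]
    gcongr
    rcases (J.erase e).eq_empty_or_nonempty with h0 | hne
    · simp [h0, cascadeSum_zero]
    refine cascadeSum_le_bpaValue_of_le_bpaObjective hU hanti hμ herase hne (fun e' he' => ?_)
      (ih _ (Finset.erase_ssubset he) herase)
    rw [evenSplit_of_mem (Finset.mem_of_mem_erase he')]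
    exact div_card_le_div_card hμ (J.erase_subset e) hne

theorem cascadeSum_le_bpaValue (hJ : J ⊆ N.outLinks v) {r : E → ℝ}
    (hr : ∀ e ∈ J, r e ≤ μ / J.card) :
    cascadeSum (N.branchValue v) J.card μ ≤ N.bpaValue v J r μ := by
  rcases J.eq_empty_or_nonempty with rfl | hne
  · simp [cascadeSum_zero]
  · exact cascadeSum_le_bpaValue_of_le_bpaObjective hU hanti hμ hJ hne hr
      (cascadeSum_le_bpaObjective_evenSplit hU hanti hμ hJ)

theorem nodeValue_eq_cascadeSum (hv : v ≠ Fin.last n) :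
    N.nodeValue v μ = cascadeSum (N.branchValue v) (N.outLinks v).card μ :=
  le_antisymm (bpaValue_le_cascadeSum hU hanti hμ hv subset_rfl 0)
    (cascadeSum_le_bpaValue hU hanti hμ subset_rfl fun _ _ => by
      simp only [Pi.zero_apply]; positivity)

end Node

theorem strictAntiUntilZero_linkValue {e : E}
    (h : N.head e ≠ Fin.last n → StrictAntiUntilZero (N.nodeValue (N.head e))) :
    StrictAntiUntilZero (N.linkValue e) := by
  by_cases hl : N.head e = Fin.last n
  · have : N.linkValue e = fun x => ENNReal.ofReal (N.cap e - x) := by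
      simp [linkValue_eq, hl, nodeValue_last]
    exact this ▸ strictAntiUntilZero_ofReal_sub _
  · exact (strictAntiUntilZero_ofReal_sub _).min (h hl)

theorem strictAntiUntilZero_branchValue {v : Fin (n + 1)} (hU : ∀ u, v ≤ u → N.IsUniformAt u) :
    StrictAntiUntilZero (N.branchValue v) := by
  induction v using WellFoundedGT.induction with
  | ind v ih =>
    rcases eq_or_ne v (Fin.last n) with rfl | hv
    · intro x y _ _ hpos
      simp [branchValue, outLinks_last] at hpos
    obtain ⟨e, rfl⟩ := N.exists_out v hv
    refine .congr (strictAntiUntilZero_linkValue fun hl => ?_)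
      (hU _ le_rfl).branchValue_eq.symm
    have hlt := N.tail_lt_head e
    have hhead := ih (N.head e) hlt fun u hu => hU u (hlt.le.trans hu)
    exact .congr (hhead.cascadeSum (branchValue_ne_top _) (outLinks_nonempty hl).card_ne_zero)
      fun x hx => (nodeValue_eq_cascadeSum (hU _ hlt.le) hhead.antitoneOn hx hl).symm

theorem SameSubtree.nodeValue_eqOn {m u w : Fin (n + 1)} (hS : N.SameSubtree u w)
    (hU : ∀ v, m < v → N.IsUniformAt v) (hu : m < u) (hw : m < w) :
    Set.EqOn (N.nodeValue u) (N.nodeValue w) (Set.Ici 0) := by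
  induction hS with
  | leaf => exact fun _ _ => rfl
  | node u w hul hwl φ hcap hsub ih =>
    intro μ hμ
    have hanti (v) (hv : m < v) : AntitoneOn (N.branchValue v) (Set.Ici 0) :=
      (strictAntiUntilZero_branchValue fun u hu => hU u (hv.trans_le hu)).antitoneOn
    have hcard : (N.outLinks u).card = (N.outLinks w).card := by
      simp only [outLinks, ← Fintype.card_subtype]
      exact Fintype.card_congr φ
    obtain ⟨e, he⟩ := N.exists_out u hul
    have hlink : Set.EqOn (N.linkValue e) (N.linkValue (φ ⟨e, he⟩)) (Set.Ici 0) := fun x hx => by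
      simp only [linkValue_eq, hcap ⟨e, he⟩, ih ⟨e, he⟩ (hu.trans (he ▸ N.tail_lt_head e))
        (hw.trans ((φ ⟨e, he⟩).2.ge.trans_lt (N.tail_lt_head _))) hx]
    rw [nodeValue_eq_cascadeSum (hU u hu) (hanti u hu) hμ hul,
      nodeValue_eq_cascadeSum (hU w hw) (hanti w hw) hμ hwl, hcard]
    refine cascadeSum_congr (fun x hx => ?_) hμ
    rw [← (hU u hu).linkValue_eq he hx, hlink hx, (hU w hw).linkValue_eq (φ ⟨e, he⟩).2 hx]

theorem IsSymmetric.isUniformAt (hSymm : N.IsSymmetric) (v : Fin (n + 1)) : N.IsUniformAt v := by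
  induction v using WellFoundedGT.induction with
  | ind v ih =>
    intro e e' he he' x hx
    cases hSymm.symmetricAt v with
    | leaf => exact absurd he (N.tail_ne_last e)
    | node _ _ hcap hsub hsame =>
      simp only [linkValue_eq, hcap e e' he he', (hsame e e' he he').nodeValue_eqOn ih
        (he ▸ N.tail_lt_head e) (he' ▸ N.tail_lt_head e') hx]

/-- The policy splits the inflow evenly among the active links wherever a link has a positive value
under the even split. -/
def IsEvenWherePositive (N : FlowNetwork n E) (G : RoutingMap n E) : Prop :=
  ∀ v, ∀ J ⊆ N.outLinks v, ∀ μ, 0 ≤ μ → 0 < N.branchValue v (μ / J.card) →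
    ∀ e ∈ J, G v J μ e = μ / J.card

-- A maximizer is worth at least the even split, which forces every link to carry at most the even
-- share.
theorem eq_div_card_of_mem_bpaArgmax {v : Fin (n + 1)} (hU : N.IsUniformAt v)
    (hv : StrictAntiUntilZero (N.branchValue v)) {J : Finset E} (hJ : J ⊆ N.outLinks v)
    {r x : E → ℝ} {μ : ℝ} (hμ : 0 ≤ μ) (hr : ∀ e ∈ J, r e ≤ μ / J.card)
    (hpos : 0 < N.branchValue v (μ / J.card))
    (hx : (feasibleSplits N.cap J r μ).Nonempty → x ∈ N.bpaArgmax v J r μ) :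
    ∀ e ∈ J, x e = μ / J.card := by
  rcases J.eq_empty_or_nonempty with rfl | hne
  · simp
  have hμJ : 0 ≤ μ / J.card := by positivity
  have hfeas : evenSplit J μ ∈ feasibleSplits N.cap J r μ :=
    evenSplit_mem_feasibleSplits hne hμ hr fun e he => by
      rw [← hU.linkValue_eq (mem_outLinks.1 (hJ he)) hμJ] at hpos
      exact (lt_cap_of_linkValue_pos hpos).le
  obtain ⟨hxfeas, hmax⟩ := hx ⟨_, hfeas⟩
  have hle : ∀ e ∈ J, x e ≤ μ / J.card := by
    intro e he
    have herase : J.erase e ⊆ N.outLinks v := (J.erase_subset e).trans hJ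
    refine hv.le_of_le hμJ hpos ?_
    rw [← hU.linkValue_eq (mem_outLinks.1 (hJ he)) (hxfeas.1 e he).1,
      ← ENNReal.add_le_add_iff_left (cascadeSum_ne_top (branchValue_ne_top (N := N) v))]
    calc cascadeSum (N.branchValue v) (J.erase e).card μ + N.branchValue v (μ / J.card)
        = cascadeSum (N.branchValue v) J.card μ := cascadeSum_card_erase_add he
      _ ≤ N.bpaObjective v J μ x :=
        (cascadeSum_le_bpaObjective_evenSplit hU hv.antitoneOn hμ hJ).trans (hmax _ hfeas)
      _ ≤ N.linkValue e (x e) + N.bpaValue v (J.erase e) x μ := iInf₂_le e he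
      _ ≤ cascadeSum (N.branchValue v) (J.erase e).card μ + N.linkValue e (x e) := by
        rw [add_comm]
        gcongr
        exact bpaValue_le_cascadeSum hU hv.antitoneOn hμ (ne_last_of_subset_outLinks hJ hne)
          herase x
  refine (Finset.sum_eq_sum_iff_of_le hle).1 ?_
  rw [hxfeas.2.2, Finset.sum_const, nsmul_eq_mul,
    mul_div_cancel₀ _ (by exact_mod_cast hne.card_ne_zero)]

theorem IsBPARouting.isEvenWherePositive {G : RoutingMap n E} (hBPA : N.IsBPARouting G)
    (hU : ∀ v, N.IsUniformAt v) : N.IsEvenWherePositive G := by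
  intro v J hJ μ hμ hpos e he
  have hanti : StrictAntiUntilZero (N.branchValue v) :=
    strictAntiUntilZero_branchValue fun u _ => hU u
  have hv : v ≠ Fin.last n := ne_last_of_subset_outLinks hJ ⟨e, he⟩
  have hfull : 0 < N.branchValue v (μ / (N.outLinks v).card) →
      ∀ e ∈ N.outLinks v, G v (N.outLinks v) μ e = μ / (N.outLinks v).card := fun hpos =>
    eq_div_card_of_mem_bpaArgmax (hU v) hanti subset_rfl hμ
      (fun _ _ => by simp only [Pi.zero_apply]; positivity) hpos (hBPA v hv μ hμ).1
  rcases hJ.eq_or_ssubset with rfl | hss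
  · exact hfull hpos e he
  have hcard : μ / (N.outLinks v).card ≤ μ / J.card := div_card_le_div_card hμ hJ ⟨e, he⟩
  have hpos' : 0 < N.branchValue v (μ / (N.outLinks v).card) :=
    hpos.trans_le (hanti.antitoneOn (Set.mem_Ici.2 (by positivity))
      (Set.mem_Ici.2 (by positivity)) hcard)
  exact eq_div_card_of_mem_bpaArgmax (hU v) hanti hJ hμ
    (fun e' he' => (hfull hpos' e' (hJ he')).trans_le hcard) hpos
    ((hBPA v hv μ hμ).2 J hss ⟨e, he⟩) e he

end Values

section Tree

variable {n : ℕ} {E : Type*} {N : FlowNetwork n E}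

/-- Every node other than the destination has at most one incoming link. -/
def HasUniqueInLinks (N : FlowNetwork n E) : Prop :=
  Set.InjOn N.head {e | N.head e ≠ Fin.last n}

variable (N) in
/-- The links that do not end in the destination, that is, those of `N.underlyingGraph`. -/
abbrev InnerLink : Type _ := {e : E // N.head e ≠ Fin.last n}

theorem IsDirectedTree.exists_injective_edgeSet (h : N.IsDirectedTree) :
    ∃ φ : N.InnerLink → N.underlyingGraph.edgeSet, Function.Injective φ := by
  have hadj : ∀ a : N.InnerLink,
      N.underlyingGraph.Adj ⟨N.tail a, N.tail_ne_last a⟩ ⟨N.head a, a.2⟩ := fun a =>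
    (SimpleGraph.fromRel_adj _ _ _).2
      ⟨fun h => (N.tail_lt_head a).ne (congrArg Subtype.val h), Or.inl ⟨a, rfl, rfl⟩⟩
  refine ⟨fun a => ⟨s(_, _), hadj a⟩, fun a b hab => ?_⟩
  have hedge := congrArg Subtype.val hab
  simp only [Sym2.eq_iff, Subtype.mk.injEq] at hedge
  rcases hedge with ⟨htail, hhead⟩ | ⟨htail, hhead⟩
  · exact Subtype.ext (h.2 _ _ a.2 htail hhead)
  · exact absurd (htail ▸ hhead ▸ N.tail_lt_head a) (N.tail_lt_head b).not_gt

variable (N) in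
/-- The head of an inner link, and the origin for `none`. -/
def headOrOrigin (a : Option N.InnerLink) : {v : Fin (n + 1) // v ≠ Fin.last n} :=
  a.elim ⟨0, N.zero_ne_last⟩ fun a => ⟨N.head a, a.2⟩

theorem headOrOrigin_surjective : Function.Surjective N.headOrOrigin := by
  rintro ⟨v, hv⟩
  rcases eq_or_ne v 0 with rfl | h0
  · exact ⟨none, rfl⟩
  · obtain ⟨e, rfl⟩ := N.exists_in v h0
    exact ⟨some ⟨e, hv⟩, rfl⟩

-- A tree has one edge less than it has nodes, so the heads of its links cannot repeat.
theorem IsDirectedTree.hasUniqueInLinks (h : N.IsDirectedTree) : N.HasUniqueInLinks := by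
  obtain ⟨φ, hφ⟩ := h.exists_injective_edgeSet
  have : Finite N.InnerLink := Finite.of_injective φ hφ
  have hcard : Nat.card (Option N.InnerLink) ≤ Nat.card {v : Fin (n + 1) // v ≠ Fin.last n} := by
    rw [Finite.card_option, ← (SimpleGraph.isTree_iff_connected_and_card.1 h.1).2]
    exact Nat.add_le_add_right (Nat.card_le_card_of_injective φ hφ) 1
  have hinj := (headOrOrigin_surjective.bijective_of_nat_card_le hcard).1
  intro e he e' he' hee
  have := @hinj (some ⟨e, he⟩) (some ⟨e', he'⟩) (Subtype.ext hee)
  simpa using this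

end Tree

section Dynamics

variable {n : ℕ} {E : Type*} [Fintype E] {N : FlowNetwork n E} {lam : ℝ}
  {G : RoutingMap n E} {δ : ℕ → E → ℝ}

theorem IsRoutingPolicy.initialInflow_nonneg (hG : N.IsRoutingPolicy G) (hlam : 0 ≤ lam)
    (v : Fin (n + 1)) : 0 ≤ N.initialInflow lam G v := by
  induction v using WellFoundedLT.induction with
  | ind v ih =>
    rw [initialInflow]
    refine add_nonneg (by split_ifs <;> simp [hlam]) (Finset.sum_nonneg fun e _ => ?_)
    have hlt : N.tail e.1 < v := (N.tail_lt_head e.1).trans_eq e.2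
    exact (hG _ (N.tail_ne_last e) _ subset_rfl (outLinks_nonempty (N.tail_ne_last e)) _
      (ih _ hlt)).1 e

variable [DecidableEq E]

@[simp]
theorem mem_activeOut {s : FlowState n E} {v : Fin (n + 1)} {e : E} :
    e ∈ N.activeOut s v ↔ N.tail e = v ∧ e ∈ s.links := by
  simp [activeOut]

theorem activeOut_subset (s : FlowState n E) (v : Fin (n + 1)) :
    N.activeOut s v ⊆ N.outLinks v := Finset.inter_subset_left

theorem activeOut_mono {s s' : FlowState n E} (h : s.links ⊆ s'.links) (v : Fin (n + 1)) :
    N.activeOut s v ⊆ N.activeOut s' v := Finset.inter_subset_inter_left h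

theorem inflow_eq_sum_ite (s : FlowState n E) (v : Fin (n + 1)) :
    N.inflow lam s v =
      (if v = 0 then lam else 0) + ∑ e ∈ N.inLinks v, if e ∈ s.links then s.flow e else 0 := by
  rw [inflow, Finset.sum_ite_mem]

theorem inflow_zero (s : FlowState n E) : N.inflow lam s 0 = lam := by
  have : N.inLinks 0 = ∅ := Finset.eq_empty_of_forall_notMem fun e he =>
    N.head_ne_zero e (mem_inLinks.1 he)
  simp [inflow, this]

theorem HasUniqueInLinks.inflow_head (h : N.HasUniqueInLinks) {s : FlowState n E} {e : E}
    (he : e ∈ s.links) (hl : N.head e ≠ Fin.last n) : N.inflow lam s (N.head e) = s.flow e := by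
  have : N.inLinks (N.head e) ∩ s.links = {e} := by
    ext e'
    simp only [Finset.mem_inter, mem_inLinks, Finset.mem_singleton]
    constructor
    · rintro ⟨hhead, -⟩
      exact h (hhead.trans_ne hl) hl hhead
    · rintro rfl
      exact ⟨rfl, he⟩
  rw [inflow, if_neg (N.head_ne_zero e), this, Finset.sum_singleton, zero_add]

section Trajectory

variable (N lam G δ)

theorem links_antitone : Antitone fun t => (N.state lam G δ t).links :=
  antitone_nat_of_succ_le fun _ => Finset.filter_subset _ _

theorem nodes_antitone : Antitone fun t => (N.state lam G δ t).nodes :=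
  antitone_nat_of_succ_le fun _ => Finset.filter_subset _ _

theorem rescap_state (t : ℕ) (e : E) :
    (N.state lam G δ t).rescap e = N.cap e - ∑ s ∈ Finset.range t, δ (s + 1) e := by
  induction t with
  | zero => simp [state, initialState]
  | succ t ih =>
    change (N.state lam G δ t).rescap e - δ (t + 1) e = _
    rw [ih, Finset.sum_range_succ, sub_sub]

theorem flow_state_succ (t : ℕ) (e : E) :
    (N.state lam G δ (t + 1)).flow e =
      if e ∈ (N.state lam G δ t).links then
        G (N.tail e) (N.activeOut (N.state lam G δ t) (N.tail e))
          (N.inflow lam (N.state lam G δ t) (N.tail e)) e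
      else 0 := rfl

theorem activeOut_eq_empty_of_notMem_nodes (t : ℕ) {v : Fin (n + 1)} (hv : v ≠ Fin.last n)
    (h : v ∉ (N.state lam G δ t).nodes) : N.activeOut (N.state lam G δ t) v = ∅ := by
  induction t with
  | zero => simp [state, initialState, hv] at h
  | succ t ih =>
    have hempty : N.activeOut (N.state lam G δ t) v = ∅ := by
      by_contra hne
      exact h (Finset.mem_filter.2 ⟨not_imp_comm.1 ih hne, Finset.nonempty_iff_ne_empty.2 hne⟩)
    exact Finset.subset_empty.1 (hempty ▸ activeOut_mono (N.links_antitone lam G δ t.le_succ) v)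

theorem inflow_initialState (v : Fin (n + 1)) :
    N.inflow lam (N.initialState lam G) v = N.initialInflow lam G v := by
  rw [initialInflow, inflow, initialState, Finset.inter_univ]
  congr 1
  exact Finset.sum_subtype _ (fun _ => mem_inLinks) _

theorem exists_flow_eq (t : ℕ) {e : E} (he : e ∈ (N.state lam G δ t).links) :
    ∃ t' ≤ t, (N.state lam G δ t).flow e =
      G (N.tail e) (N.activeOut (N.state lam G δ t') (N.tail e))
        (N.inflow lam (N.state lam G δ t') (N.tail e)) e := by
  cases t with
  | zero =>
    refine ⟨0, le_rfl, ?_⟩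
    simp only [state, inflow_initialState]
    simp [activeOut, initialState]
  | succ t => exact ⟨t, t.le_succ, if_pos (N.links_antitone lam G δ t.le_succ he)⟩

end Trajectory

section Settling

variable (N lam G δ)

theorem eventuallyConst_links : EventuallyConst (fun t => (N.state lam G δ t).links) atTop :=
  eventuallyConst_of_antitone (N.links_antitone lam G δ)

theorem eventuallyConst_inflow {v : Fin (n + 1)}
    (h : ∀ e, N.head e = v → EventuallyConst (fun t => (N.state lam G δ t).flow e) atTop) :
    EventuallyConst (fun t => N.inflow lam (N.state lam G δ t) v) atTop := by
  have hin : EventuallyConst (fun t (e : N.inLinks v) => (N.state lam G δ t).flow e) atTop :=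
    eventuallyConst_pi fun e => h e (mem_inLinks.1 e.2)
  let F (L : Finset E) (f : N.inLinks v → ℝ) : ℝ :=
    (if v = 0 then lam else 0) + ∑ e, if e.1 ∈ L then f e else 0
  refine ((N.eventuallyConst_links lam G δ).comp₂ F hin).congr (.of_forall fun t => ?_)
  simp only [F, inflow_eq_sum_ite]
  rw [← Finset.sum_coe_sort (N.inLinks v)]

theorem eventuallyConst_flow (e : E) :
    EventuallyConst (fun t => (N.state lam G δ t).flow e) atTop := by
  induction hv : N.tail e using WellFoundedLT.induction generalizing e with
  | ind v ih =>
    subst hv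
    have hin := N.eventuallyConst_inflow lam G δ (v := N.tail e) fun e' he' =>
      ih _ (he' ▸ N.tail_lt_head e') e' rfl
    have hsucc : EventuallyConst (fun t => (N.state lam G δ (t + 1)).flow e) atTop :=
      (N.eventuallyConst_links lam G δ).comp₂ (fun L μ =>
        if e ∈ L then G (N.tail e) (N.outLinks (N.tail e) ∩ L) μ e else 0) hin
    rw [EventuallyConst, ← map_add_atTop_eq_nat 1, map_map]
    exact hsucc

/-- From time `T` on, links, nodes and flow do not change. -/
structure SettledFrom (T : ℕ) : Prop where
  links_eq : ∀ t ≥ T, (N.state lam G δ t).links = (N.state lam G δ T).links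
  nodes_eq : ∀ t ≥ T, (N.state lam G δ t).nodes = (N.state lam G δ T).nodes
  flow_eq : ∀ t ≥ T, (N.state lam G δ t).flow = (N.state lam G δ T).flow

theorem exists_settledFrom (T₀ : ℕ) : ∃ T ≥ T₀, N.SettledFrom lam G δ T := by
  have hnodes := eventuallyConst_of_antitone (N.nodes_antitone lam G δ)
  have hflow : EventuallyConst (fun t => (N.state lam G δ t).flow) atTop :=
    eventuallyConst_pi (N.eventuallyConst_flow lam G δ)
  obtain ⟨T, hT⟩ := eventuallyConst_atTop.1
    ((N.eventuallyConst_links lam G δ).prodMk (hnodes.prodMk hflow))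
  simp only [Prod.mk.injEq] at hT
  have hmax (t) (ht : t ≥ max T₀ T) := hT t ((le_max_right _ _).trans ht)
  have hT' := hT (max T₀ T) (le_max_right _ _)
  exact ⟨max T₀ T, le_max_left _ _, fun t ht => (hmax t ht).1.trans hT'.1.symm,
    fun t ht => (hmax t ht).2.1.trans hT'.2.1.symm, fun t ht => (hmax t ht).2.2.trans hT'.2.2.symm⟩

/-- The dynamics without disturbance changes neither the links nor the nodes nor the flow of the
state. -/
structure IsSettled (N : FlowNetwork n E) (lam : ℝ) (G : RoutingMap n E) (s : FlowState n E) :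
    Prop where
  flow_lt : ∀ e ∈ s.links, s.flow e < s.rescap e
  head_mem : ∀ e ∈ s.links, N.head e = Fin.last n ∨ N.head e ∈ s.nodes
  out_nonempty : ∀ v ∈ s.nodes, (N.activeOut s v).Nonempty
  flow_eq : ∀ e ∈ s.links,
    s.flow e = G (N.tail e) (N.activeOut s (N.tail e)) (N.inflow lam s (N.tail e)) e
  flow_eq_zero : ∀ e ∉ s.links, s.flow e = 0

variable {N lam G δ}

theorem SettledFrom.isSettled {T : ℕ} (h : N.SettledFrom lam G δ T) :
    N.IsSettled lam G (N.state lam G δ T) where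
  flow_lt _ he := (Finset.mem_filter.1 ((h.links_eq (T + 1) T.le_succ).superset he)).2.1
  head_mem _ he := (Finset.mem_filter.1 ((h.links_eq (T + 1) T.le_succ).superset he)).2.2
  out_nonempty _ hv := (Finset.mem_filter.1 ((h.nodes_eq (T + 1) T.le_succ).superset hv)).2
  flow_eq e he := (congrFun (h.flow_eq (T + 1) T.le_succ) e).symm.trans (if_pos he)
  flow_eq_zero e he := (congrFun (h.flow_eq (T + 1) T.le_succ) e).symm.trans (if_neg he)

theorem IsSettled.activeOut_head_nonempty {s : FlowState n E} (hs : N.IsSettled lam G s) {e : E}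
    (he : e ∈ s.links) (hl : N.head e ≠ Fin.last n) : (N.activeOut s (N.head e)).Nonempty :=
  hs.out_nonempty _ ((hs.head_mem e he).resolve_left hl)

end Settling

section Conservation

theorem sum_sum_activeOut_flow (N : FlowNetwork n E) (s : FlowState n E) :
    ∑ v, ∑ e ∈ N.activeOut s v, s.flow e = ∑ e ∈ s.links, s.flow e := by
  simp_rw [activeOut, outLinks, Finset.filter_inter, Finset.univ_inter]
  exact Finset.sum_fiberwise _ _ _

theorem sum_inflow (N : FlowNetwork n E) (lam : ℝ) (s : FlowState n E) :
    ∑ v, N.inflow lam s v = lam + ∑ e ∈ s.links, s.flow e := by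
  simp_rw [inflow, inLinks, Finset.filter_inter, Finset.univ_inter, Finset.sum_add_distrib]
  rw [Finset.sum_fiberwise, Finset.sum_ite_eq' Finset.univ, if_pos (Finset.mem_univ _)]

variable (hG : N.IsRoutingPolicy G)
include hG

theorem IsRoutingPolicy.routing_nonneg {s : FlowState n E} {e : E} (he : e ∈ s.links) {μ : ℝ}
    (hμ : 0 ≤ μ) : 0 ≤ G (N.tail e) (N.activeOut s (N.tail e)) μ e :=
  (hG _ (N.tail_ne_last e) _ (activeOut_subset _ _) ⟨e, mem_activeOut.2 ⟨rfl, he⟩⟩ _ hμ).1 e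

theorem IsRoutingPolicy.inflow_nonneg (hlam : 0 ≤ lam) (t : ℕ) (v : Fin (n + 1)) :
    0 ≤ N.inflow lam (N.state lam G δ t) v := by
  induction t generalizing v with
  | zero =>
    rw [state, inflow_initialState]
    exact hG.initialInflow_nonneg hlam v
  | succ t ih =>
    refine add_nonneg (by split_ifs <;> simp [hlam]) (Finset.sum_nonneg fun e _ => ?_)
    rw [flow_state_succ]
    split_ifs with he
    · exact hG.routing_nonneg he (ih _)
    · exact le_rfl

theorem IsRoutingPolicy.flow_nonneg (hlam : 0 ≤ lam) {t : ℕ} {e : E}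
    (he : e ∈ (N.state lam G δ t).links) : 0 ≤ (N.state lam G δ t).flow e := by
  obtain ⟨t', ht', heq⟩ := N.exists_flow_eq lam G δ t he
  rw [heq]
  exact hG.routing_nonneg (N.links_antitone lam G δ ht' he) (hG.inflow_nonneg hlam t' _)

theorem IsSettled.sum_flow {s : FlowState n E} (hs : N.IsSettled lam G s) {v : Fin (n + 1)}
    (hv : v ≠ Fin.last n) (hne : (N.activeOut s v).Nonempty) (hin : 0 ≤ N.inflow lam s v) :
    ∑ e ∈ N.activeOut s v, s.flow e = N.inflow lam s v := by
  rw [← (hG v hv _ (activeOut_subset s v) hne _ hin).2.2]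
  refine Finset.sum_congr rfl fun e he => ?_
  obtain ⟨rfl, he'⟩ := mem_activeOut.1 he
  exact hs.flow_eq e he'

theorem IsSettled.sum_flow_of_ne_zero {s : FlowState n E} (hs : N.IsSettled lam G s)
    {v : Fin (n + 1)} (hv : v ≠ Fin.last n) (hv₀ : v ≠ 0) (hin : 0 ≤ N.inflow lam s v) :
    ∑ e ∈ N.activeOut s v, s.flow e = N.inflow lam s v := by
  rcases (N.activeOut s v).eq_empty_or_nonempty with h | hne
  · have hempty : N.inLinks v ∩ s.links = ∅ := Finset.eq_empty_of_forall_notMem fun e he => by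
      rw [Finset.mem_inter, mem_inLinks] at he
      obtain ⟨rfl, he⟩ := he
      exact (hs.activeOut_head_nonempty he hv).ne_empty h
    simp [h, inflow, hv₀, hempty]
  · exact hs.sum_flow hG hv hne hin

-- Every node except the two ends passes its inflow on, so what the origin sends out arrives.
theorem IsSettled.sum_inLinks_last {s : FlowState n E} (hs : N.IsSettled lam G s)
    (hin : ∀ v, 0 ≤ N.inflow lam s v) :
    ∑ e ∈ N.inLinks (Fin.last n), s.flow e = ∑ e ∈ N.activeOut s 0, s.flow e := by
  have hlast : N.inflow lam s (Fin.last n) = ∑ e ∈ N.inLinks (Fin.last n), s.flow e := by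
    rw [inflow, if_neg N.zero_ne_last.symm, zero_add]
    exact Finset.sum_subset Finset.inter_subset_left fun e he hne => hs.flow_eq_zero e
      fun h => hne (Finset.mem_inter.2 ⟨he, h⟩)
  have hout : N.activeOut s (Fin.last n) = ∅ := by
    rw [activeOut, outLinks_last, Finset.empty_inter]
  have hbalance : ∑ v, (∑ e ∈ N.activeOut s v, s.flow e - N.inflow lam s v) = -lam := by
    rw [Finset.sum_sub_distrib, sum_sum_activeOut_flow, sum_inflow]
    ring
  rw [Fintype.sum_eq_add 0 (Fin.last n) N.zero_ne_last fun v hv =>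
    sub_eq_zero.2 (hs.sum_flow_of_ne_zero hG hv.2 hv.1 (hin v)), inflow_zero, hout, hlast,
    Finset.sum_empty] at hbalance
  linarith

theorem IsRoutingPolicy.isTransferring_iff (hlam : 0 < lam) :
    N.IsTransferring lam G δ ↔ ∀ t, (N.activeOut (N.state lam G δ t) 0).Nonempty := by
  have htendsto {T} (hT : N.SettledFrom lam G δ T) :
      Tendsto (fun t => ∑ e ∈ N.inLinks (Fin.last n), (N.state lam G δ t).flow e) atTop
        (𝓝 (∑ e ∈ N.activeOut (N.state lam G δ T) 0, (N.state lam G δ T).flow e)) :=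
    tendsto_atTop_of_eventually_const (i₀ := T) fun t ht => by
      rw [hT.flow_eq t ht, hT.isSettled.sum_inLinks_last hG (hG.inflow_nonneg hlam.le T)]
  constructor
  · intro h t
    obtain ⟨T, hTt, hT⟩ := N.exists_settledFrom lam G δ t
    have hne : (N.activeOut (N.state lam G δ T) 0).Nonempty :=
      Finset.nonempty_of_sum_ne_zero (tendsto_nhds_unique h (htendsto hT) ▸ hlam.ne')
    exact hne.mono (activeOut_mono (N.links_antitone lam G δ hTt) 0)
  · intro h
    obtain ⟨T, -, hT⟩ := N.exists_settledFrom lam G δ 0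
    have hsum := hT.isSettled.sum_flow hG N.zero_ne_last (h T) (hG.inflow_nonneg hlam.le T 0)
    rw [inflow_zero] at hsum
    exact (htendsto hT).trans (congrArg 𝓝 hsum).le

end Conservation

end Dynamics

section Damage

variable {n : ℕ} {E : Type*} [Fintype E] {N : FlowNetwork n E} {D : E → ℝ≥0∞}

/-- The total of `D` over the links of the tree hanging from `v`. -/
noncomputable def subtreeSum (N : FlowNetwork n E) (D : E → ℝ≥0∞) (v : Fin (n + 1)) : ℝ≥0∞ :=
  ∑ e : {e : E // N.tail e = v}, (D e.1 + subtreeSum N D (N.head e.1))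
termination_by n - v.val
decreasing_by
  have hlt : v < N.head e.1 := e.2.symm.trans_lt (N.tail_lt_head e.1)
  have := (N.head e.1).isLt
  omega

theorem subtreeSum_eq (D : E → ℝ≥0∞) (v : Fin (n + 1)) :
    N.subtreeSum D v = ∑ e ∈ N.outLinks v, (D e + N.subtreeSum D (N.head e)) := by
  rw [subtreeSum]
  exact (Finset.sum_subtype _ (fun _ => mem_outLinks)
    fun e => D e + N.subtreeSum D (N.head e)).symm

theorem subtreeSum_last : N.subtreeSum D (Fin.last n) = 0 := by
  rw [subtreeSum_eq, outLinks_last, Finset.sum_empty]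

theorem subtreeSum_ne_top (hD : ∀ e, D e ≠ ⊤) (v : Fin (n + 1)) : N.subtreeSum D v ≠ ⊤ := by
  induction v using WellFoundedGT.induction with
  | ind v ih =>
    rw [subtreeSum_eq]
    refine ENNReal.sum_ne_top.2 fun e he => ENNReal.add_ne_top.2 ⟨hD e, ih _ ?_⟩
    exact mem_outLinks.1 he ▸ N.tail_lt_head e

theorem HasUniqueInLinks.sum_subtreeSum_head_le (h : N.HasUniqueInLinks) (D : E → ℝ≥0∞) :
    ∑ e, N.subtreeSum D (N.head e) ≤ ∑ v ∈ Finset.univ.erase 0, N.subtreeSum D v := by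
  classical
  let I : Finset E := {e | N.head e ≠ Fin.last n}
  calc ∑ e, N.subtreeSum D (N.head e)
      = ∑ e ∈ I, N.subtreeSum D (N.head e) := by
        refine (Finset.sum_subset I.subset_univ fun e _ he => ?_).symm
        have hlast : N.head e = Fin.last n := by simpa [I] using he
        rw [hlast, subtreeSum_last]
    _ = ∑ v ∈ I.image N.head, N.subtreeSum D v :=
        (Finset.sum_image (h.mono fun e he => by simpa [I] using he)).symm
    _ ≤ ∑ v ∈ Finset.univ.erase 0, N.subtreeSum D v := by
        refine Finset.sum_le_sum_of_subset (Finset.image_subset_iff.2 fun e _ => ?_)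
        exact Finset.mem_erase.2 ⟨N.head_ne_zero e, Finset.mem_univ _⟩

theorem HasUniqueInLinks.subtreeSum_zero_le (h : N.HasUniqueInLinks) (hD : ∀ e, D e ≠ ⊤) :
    N.subtreeSum D 0 ≤ ∑ e, D e := by
  have hrest : ∑ v ∈ Finset.univ.erase 0, N.subtreeSum D v ≠ ⊤ :=
    ENNReal.sum_ne_top.2 fun v _ => subtreeSum_ne_top hD v
  refine (ENNReal.add_le_add_iff_right hrest).1 ?_
  calc N.subtreeSum D 0 + ∑ v ∈ Finset.univ.erase 0, N.subtreeSum D v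
      = ∑ v, ∑ e with N.tail e = v, (D e + N.subtreeSum D (N.head e)) := by
        rw [Finset.add_sum_erase _ _ (Finset.mem_univ 0)]
        exact Finset.sum_congr rfl fun v _ => subtreeSum_eq D v
    _ = ∑ e, D e + ∑ e, N.subtreeSum D (N.head e) := by
        rw [Finset.sum_fiberwise, Finset.sum_add_distrib]
    _ ≤ ∑ e, D e + ∑ v ∈ Finset.univ.erase 0, N.subtreeSum D v := by
        gcongr
        exact h.sum_subtreeSum_head_le D

end Damage

section LowerBound

variable {n : ℕ} {E : Type*} {N : FlowNetwork n E} {lam : ℝ} {G : RoutingMap n E}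
  {δ : ℕ → E → ℝ}

/-- The capacity that the disturbance `δ` removes from the link `e`. -/
noncomputable def removedCap (δ : ℕ → E → ℝ) (e : E) : ℝ≥0∞ :=
  ∑' t, ENNReal.ofReal (δ (t + 1) e)

theorem IsDisturbance.ofReal_sum_le_removedCap (hδ : N.IsDisturbance δ) (t : ℕ) (e : E) :
    ENNReal.ofReal (∑ s ∈ Finset.range t, δ (s + 1) e) ≤ removedCap δ e := by
  rw [ENNReal.ofReal_sum_of_nonneg fun s _ => hδ.1 s e]
  exact ENNReal.sum_le_tsum _

variable [Fintype E] [DecidableEq E]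

theorem IsDisturbance.ofReal_cap_sub_le_removedCap (hδ : N.IsDisturbance δ) {t : ℕ} {e : E} {x : ℝ}
    (h : (N.state lam G δ t).rescap e ≤ x) : ENNReal.ofReal (N.cap e - x) ≤ removedCap δ e := by
  refine (ENNReal.ofReal_le_ofReal ?_).trans (hδ.ofReal_sum_le_removedCap t e)
  rw [rescap_state] at h
  linarith

theorem rescap_le_flow_or_head_notMem_nodes {t : ℕ} {e : E}
    (he : e ∈ (N.state lam G δ t).links) (he' : e ∉ (N.state lam G δ (t + 1)).links) :
    (N.state lam G δ t).rescap e ≤ (N.state lam G δ t).flow e ∨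
      N.head e ≠ Fin.last n ∧ N.head e ∉ (N.state lam G δ t).nodes := by
  by_contra! hcon
  exact he' (Finset.mem_filter.2 ⟨he, hcon.1, or_iff_not_imp_left.2 hcon.2⟩)

namespace IsEvenWherePositive

variable (hE : N.IsEvenWherePositive G) (hG : N.IsRoutingPolicy G) (hU : ∀ v, N.IsUniformAt v)
  (hlam : 0 ≤ lam)
include hE hG hU hlam

theorem flow_le {t : ℕ} {e : E} (he : e ∈ (N.state lam G δ t).links) {μ : ℝ}
    (hμ : ∀ s ≤ t, N.inflow lam (N.state lam G δ s) (N.tail e) ≤ μ)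
    (hpos : 0 < N.branchValue (N.tail e) (μ / (N.activeOut (N.state lam G δ t) (N.tail e)).card))
    {s : ℕ} (hst : s ≤ t) :
    (N.state lam G δ s).flow e ≤ μ / (N.activeOut (N.state lam G δ t) (N.tail e)).card := by
  obtain ⟨r, hrs, hflow⟩ := N.exists_flow_eq lam G δ s (N.links_antitone lam G δ hst he)
  have hrt := hrs.trans hst
  have hin := hG.inflow_nonneg (δ := δ) hlam r (N.tail e)
  have hmem : e ∈ N.activeOut (N.state lam G δ t) (N.tail e) := mem_activeOut.2 ⟨rfl, he⟩
  have hsub := activeOut_mono (N := N) (N.links_antitone lam G δ hrt) (N.tail e)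
  have hle : N.inflow lam (N.state lam G δ r) (N.tail e) /
      (N.activeOut (N.state lam G δ r) (N.tail e)).card ≤
        μ / (N.activeOut (N.state lam G δ t) (N.tail e)).card :=
    (div_card_le_div_card hin hsub ⟨e, hmem⟩).trans (by gcongr; exact hμ r hrt)
  have hanti := (strictAntiUntilZero_branchValue (v := N.tail e) fun u _ => hU u).antitoneOn
  have hpos_r := hpos.trans_le (hanti (Set.mem_Ici.2 (by positivity))
    (Set.mem_Ici.2 ((by positivity : (0 : ℝ) ≤ _).trans hle)) hle)
  rw [hflow, hE _ _ (activeOut_subset _ _) _ hin hpos_r e (hsub hmem)]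
  exact hle

-- A link fails by itself only if its spare capacity has been removed, and otherwise only because
-- its head has failed under at most the flow of the link.
theorem branchValue_le_of_link_fails (huniq : N.HasUniqueInLinks) (hδ : N.IsDisturbance δ)
    {t : ℕ} {e : E} (he : e ∈ (N.state lam G δ t).links)
    (he' : e ∉ (N.state lam G δ (t + 1)).links) {μ : ℝ}
    (hμ : ∀ s ≤ t, N.inflow lam (N.state lam G δ s) (N.tail e) ≤ μ) {c : ℝ≥0∞}
    (hhead : ∀ x, (∀ s ≤ t, N.inflow lam (N.state lam G δ s) (N.head e) ≤ x) →
      N.head e ≠ Fin.last n → N.activeOut (N.state lam G δ t) (N.head e) = ∅ →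
        N.nodeValue (N.head e) x ≤ c) :
    N.branchValue (N.tail e) (μ / (N.activeOut (N.state lam G δ t) (N.tail e)).card) ≤
      removedCap δ e + c := by
  rcases eq_zero_or_pos
    (N.branchValue (N.tail e) (μ / (N.activeOut (N.state lam G δ t) (N.tail e)).card)) with
    h0 | hpos
  · exact h0.trans_le zero_le
  have hflow {s} (hs : s ≤ t) := hE.flow_le hG hU hlam he hμ hpos hs
  have hload := (hG.flow_nonneg hlam he).trans (hflow le_rfl)
  rw [← (hU _).linkValue_eq rfl hload, linkValue_eq]
  rcases rescap_le_flow_or_head_notMem_nodes he he' with hcap | ⟨hl, hdead⟩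
  · exact (min_le_left _ _).trans
      (le_add_right (hδ.ofReal_cap_sub_le_removedCap (hcap.trans (hflow le_rfl))))
  · refine (min_le_right _ _).trans (le_add_left (hhead _ (fun s hs => ?_) hl
      (N.activeOut_eq_empty_of_notMem_nodes lam G δ t hl hdead)))
    rw [huniq.inflow_head (N.links_antitone lam G δ hs he) hl]
    exact hflow hs

theorem nodeValue_le_subtreeSum (huniq : N.HasUniqueInLinks) (hδ : N.IsDisturbance δ)
    {v : Fin (n + 1)} (hv : v ≠ Fin.last n) {T : ℕ} {μ : ℝ}
    (hμ : ∀ t ≤ T, N.inflow lam (N.state lam G δ t) v ≤ μ)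
    (hdead : N.activeOut (N.state lam G δ T) v = ∅) :
    N.nodeValue v μ ≤ N.subtreeSum (removedCap δ) v := by
  induction v using WellFoundedGT.induction generalizing T μ with
  | ind v ih =>
    have hμ₀ : 0 ≤ μ := (hG.inflow_nonneg (δ := δ) hlam 0 v).trans (hμ 0 T.zero_le)
    have hanti := (strictAntiUntilZero_branchValue (v := v) fun u _ => hU u).antitoneOn
    have hactive : Antitone fun t => N.activeOut (N.state lam G δ t) v := fun _ _ hst =>
      activeOut_mono (N.links_antitone lam G δ hst) v
    have hinit : N.activeOut (N.state lam G δ 0) v = N.outLinks v := Finset.inter_univ _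
    have hcascade := cascadeSum_card_le_sum_of_antitone hanti hμ₀
      (w := fun e => removedCap δ e + N.subtreeSum (removedCap δ) (N.head e)) hactive (T := T)
      fun t ht e hfails => by
        obtain ⟨hmem, hnot⟩ := Finset.mem_sdiff.1 hfails
        obtain ⟨rfl, he⟩ := mem_activeOut.1 hmem
        exact hE.branchValue_le_of_link_fails hG hU hlam huniq hδ he
          (fun he' => hnot (mem_activeOut.2 ⟨rfl, he'⟩)) (fun s hs => hμ s (hs.trans ht.le))
          fun x hx hl hempty => ih _ (N.tail_lt_head e) hl hx hempty
    rw [hinit, hdead, Finset.sdiff_empty, Finset.card_empty, cascadeSum_zero, add_zero] at hcascade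
    rwa [nodeValue_eq_cascadeSum (hU v) hanti hμ₀ hv, subtreeSum_eq]

end IsEvenWherePositive

theorem IsEvenWherePositive.isTransferring (hE : N.IsEvenWherePositive G)
    (hG : N.IsRoutingPolicy G) (hU : ∀ v, N.IsUniformAt v) (hlam : 0 < lam)
    (huniq : N.HasUniqueInLinks) (hδ : N.IsDisturbance δ)
    (hlt : disturbanceMagnitude δ < N.bpaBound lam) : N.IsTransferring lam G δ := by
  refine (hG.isTransferring_iff hlam).2 fun T => ?_
  by_contra hdead
  refine hlt.not_ge ?_
  calc N.bpaBound lam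
      ≤ N.subtreeSum (removedCap δ) 0 :=
        hE.nodeValue_le_subtreeSum hG hU hlam.le huniq hδ N.zero_ne_last
          (fun t _ => (inflow_zero _).le) (Finset.not_nonempty_iff_eq_empty.1 hdead)
    _ ≤ disturbanceMagnitude δ := huniq.subtreeSum_zero_le fun e =>
        ENNReal.sum_ne_top.1 hlt.ne_top e (Finset.mem_univ e)

theorem IsEvenWherePositive.bpaBound_le_resilience (hE : N.IsEvenWherePositive G)
    (hG : N.IsRoutingPolicy G) (hU : ∀ v, N.IsUniformAt v) (hlam : 0 < lam)
    (huniq : N.HasUniqueInLinks) : N.bpaBound lam ≤ N.resilience lam G :=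
  le_iInf fun _ => le_iInf fun hδ => le_iInf fun hnot =>
    not_lt.1 fun hlt => hnot (hE.isTransferring hG hU hlam huniq hδ hlt)

end LowerBound

section AttackPath

variable {n : ℕ} {E : Type*} {lam : ℝ} {G : RoutingMap n E} {s s' : FlowState n E}

/-- The capacity that must be removed from the link `e` to overload it in the state `s`. -/
noncomputable def spareCap (s : FlowState n E) (e : E) : ℝ≥0∞ :=
  ENNReal.ofReal (s.rescap e - s.flow e)

variable [Fintype E] [DecidableEq E]

/-- The cost of a cascade that makes `v` fail in the state `s`, one of the active links leaving `v`
having failed already. -/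
noncomputable def restCost (N : FlowNetwork n E) (lam : ℝ) (s : FlowState n E) (v : Fin (n + 1)) :
    ℝ≥0∞ :=
  cascadeSum (N.branchValue v) ((N.activeOut s v).card - 1) (N.inflow lam s v)

/-- `N.AttackPath lam s v e₀ b`: some path of active links starts in `v` and ends with the link
`e₀`, and `b` is the total of `N.restCost lam s` over its nodes without the head of `e₀`, that is,
the cost of making `v` fail along this path once `e₀` has failed. -/
inductive AttackPath (N : FlowNetwork n E) (lam : ℝ) (s : FlowState n E) :
    Fin (n + 1) → E → ℝ≥0∞ → Prop
  | last (e : E) (he : e ∈ s.links) :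
      AttackPath N lam s (N.tail e) e (N.restCost lam s (N.tail e))
  | cons (e : E) (he : e ∈ s.links) {e₀ : E} {b : ℝ≥0∞}
      (h : AttackPath N lam s (N.head e) e₀ b) :
      AttackPath N lam s (N.tail e) e₀ (b + N.restCost lam s (N.tail e))

variable {N : FlowNetwork n E} {v : Fin (n + 1)} {e₀ : E} {b : ℝ≥0∞}

theorem AttackPath.ne_last (h : N.AttackPath lam s v e₀ b) : v ≠ Fin.last n := by
  cases h <;> exact N.tail_ne_last _

theorem AttackPath.mem_links (h : N.AttackPath lam s v e₀ b) : e₀ ∈ s.links := by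
  induction h with
  | last _ he => exact he
  | cons _ _ _ ih => exact ih

theorem branchValue_add_restCost (h : (N.activeOut s v).Nonempty) :
    N.branchValue v (N.inflow lam s v / (N.activeOut s v).card) + N.restCost lam s v =
      cascadeSum (N.branchValue v) (N.activeOut s v).card (N.inflow lam s v) := by
  obtain ⟨e, he⟩ := h
  rw [restCost, ← Finset.card_erase_of_mem he, add_comm, cascadeSum_card_erase_add he]

variable (hG : N.IsRoutingPolicy G) (hU : ∀ v, N.IsUniformAt v) (huniq : N.HasUniqueInLinks)
include hG hU huniq

-- The path follows links with at least the even share, as long as the head is cheaper than the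
-- link itself.
theorem IsSettled.exists_attackPath (hs : N.IsSettled lam G s)
    (hcap : ∀ e, s.rescap e ≤ N.cap e) (hin : ∀ v, 0 ≤ N.inflow lam s v) (hv : v ≠ Fin.last n)
    (hne : (N.activeOut s v).Nonempty) :
    ∃ e₀ b, N.AttackPath lam s v e₀ b ∧ spareCap s e₀ + b ≤
      cascadeSum (N.branchValue v) (N.activeOut s v).card (N.inflow lam s v) := by
  induction v using WellFoundedGT.induction with
  | ind v ih =>
    obtain ⟨e, hactive, hshare⟩ := exists_div_card_le_of_sum_eq hne (hs.sum_flow hG hv hne (hin v))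
    obtain ⟨rfl, he⟩ := mem_activeOut.1 hactive
    have heven : 0 ≤ N.inflow lam s (N.tail e) / (N.activeOut s (N.tail e)).card :=
      div_nonneg (hin _) (Nat.cast_nonneg _)
    have hvalue : N.linkValue e (s.flow e) ≤
        N.branchValue (N.tail e) (N.inflow lam s (N.tail e) / (N.activeOut s (N.tail e)).card) := by
      rw [(hU _).linkValue_eq rfl (heven.trans hshare)]
      exact (strictAntiUntilZero_branchValue fun u _ => hU u).antitoneOn heven
        (heven.trans hshare) hshare
    rw [← branchValue_add_restCost hne]
    rcases min_choice (ENNReal.ofReal (N.cap e - s.flow e)) (N.nodeValue (N.head e) (s.flow e))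
      with hmin | hmin
    · refine ⟨e, _, .last e he, ?_⟩
      gcongr
      refine le_trans ?_ (hmin.symm.trans_le hvalue)
      exact ENNReal.ofReal_le_ofReal (sub_le_sub_right (hcap e) _)
    · have hl : N.head e ≠ Fin.last n := fun hl => (linkValue_lt_top e (s.flow e)).ne
        (hmin.trans (hl ▸ nodeValue_last _))
      obtain ⟨e₀, b, hpath, hb⟩ := ih _ (N.tail_lt_head e) hl (hs.activeOut_head_nonempty he hl)
      refine ⟨e₀, _, .cons e he hpath, ?_⟩
      rw [← add_assoc]
      gcongr
      refine le_trans ?_ (hmin.symm.trans_le hvalue)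
      rw [nodeValue_eq_cascadeSum (hU _)
        (strictAntiUntilZero_branchValue fun u _ => hU u).antitoneOn (heven.trans hshare) hl,
        ← huniq.inflow_head he hl]
      exact hb.trans (cascadeSum_mono _ _ (Finset.card_le_card (activeOut_subset s _)))

theorem IsSettled.exists_attackPath_le_restCost (hs' : N.IsSettled lam G s')
    (hcap : ∀ e, s'.rescap e ≤ N.cap e) (hin : ∀ v, 0 ≤ N.inflow lam s' v) (hv : v ≠ Fin.last n)
    (hne : (N.activeOut s' v).Nonempty) (hss : N.activeOut s' v ⊂ N.activeOut s v)
    (hflow : N.inflow lam s' v = N.inflow lam s v) :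
    ∃ e₀ b, N.AttackPath lam s' v e₀ b ∧ spareCap s' e₀ + b ≤ N.restCost lam s v := by
  obtain ⟨e₀, b, hpath, hb⟩ := hs'.exists_attackPath hG hU huniq hcap hin hv hne
  refine ⟨e₀, b, hpath, hb.trans ?_⟩
  rw [hflow]
  exact cascadeSum_mono _ _ (Nat.le_pred_of_lt (Finset.card_lt_card hss))

-- Either the first node of the path that has lost a link starts a new path, or nothing but the
-- target has changed along the path.
theorem AttackPath.exists_next (hpath : N.AttackPath lam s v e₀ b) (hs : N.IsSettled lam G s)
    (hs' : N.IsSettled lam G s') (hcap : ∀ e, s'.rescap e ≤ N.cap e)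
    (hin : ∀ v, 0 ≤ N.inflow lam s' v) (hlinks : s'.links ⊆ s.links) (he₀ : e₀ ∉ s'.links)
    (hflow : N.inflow lam s' v = N.inflow lam s v) (hne : (N.activeOut s' v).Nonempty) :
    ∃ e₁ b', N.AttackPath lam s' v e₁ b' ∧ spareCap s' e₁ + b' ≤ b := by
  have hsub (v) : N.activeOut s' v ⊆ N.activeOut s v := activeOut_mono hlinks v
  induction hpath with
  | last e he =>
    refine hs'.exists_attackPath_le_restCost hG hU huniq hcap hin (N.tail_ne_last e) hne
      ((hsub _).ssubset_of_not_subset fun h => he₀ ?_) hflow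
    exact (mem_activeOut.1 (h (mem_activeOut.2 ⟨rfl, he⟩))).2
  | @cons e he e₀ b h ih =>
    rcases (hsub (N.tail e)).eq_or_ssubset with heq | hss
    · have he' : e ∈ s'.links := (mem_activeOut.1 (heq.superset (mem_activeOut.2 ⟨rfl, he⟩))).2
      have hhead : N.inflow lam s' (N.head e) = N.inflow lam s (N.head e) := by
        rw [huniq.inflow_head he' h.ne_last, huniq.inflow_head he h.ne_last, hs'.flow_eq e he',
          hs.flow_eq e he, heq, hflow]
      obtain ⟨e₁, b', hpath', hb'⟩ :=
        ih he₀ hhead (hs'.activeOut_head_nonempty he' h.ne_last)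
      refine ⟨e₁, _, .cons e he' hpath', ?_⟩
      rw [← add_assoc, restCost, heq, hflow]
      exact add_le_add_left hb' _
    · obtain ⟨e₁, b', hpath', hb'⟩ := hs'.exists_attackPath_le_restCost hG hU huniq hcap hin
        (N.tail_ne_last e) hne hss hflow
      exact ⟨e₁, b', hpath', hb'.trans le_add_self⟩

end AttackPath

section Strike

variable {n : ℕ} {E : Type*} [DecidableEq E]

/-- The disturbance `δ` with an additional capacity reduction `d` of the link `e₀` at time
`T + 1`. -/
def strike (δ : ℕ → E → ℝ) (T : ℕ) (e₀ : E) (d : ℝ) : ℕ → E → ℝ :=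
  δ + Pi.single (T + 1) (Pi.single e₀ d)

variable {N : FlowNetwork n E} {δ : ℕ → E → ℝ} {T : ℕ} {e₀ : E} {d : ℝ}

theorem strike_self : strike δ T e₀ d (T + 1) e₀ = δ (T + 1) e₀ + d := by
  simp [strike]

theorem strike_of_ne {t : ℕ} (h : t ≠ T) : strike δ T e₀ d (t + 1) = δ (t + 1) := by
  simp [strike, h]

theorem strike_of_ne_link {e : E} (h : e ≠ e₀) (t : ℕ) : strike δ T e₀ d t e = δ t e := by
  by_cases ht : t = T + 1
  · subst ht
    simp [strike, h]
  · simp [strike, ht]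

theorem le_strike (hd : 0 ≤ d) (t : ℕ) (e : E) : δ t e ≤ strike δ T e₀ d t e := by
  have h : (0 : ℕ → E → ℝ) ≤ Pi.single (T + 1) (Pi.single e₀ d) :=
    Pi.single_nonneg.2 (Pi.single_nonneg.2 hd)
  exact le_add_of_nonneg_right (h t e)

theorem isDisturbance_strike (hδ : N.IsDisturbance δ) (hzero : ∀ t ≥ T, δ (t + 1) = 0)
    (hd : 0 ≤ d) (hcap : ∑ s ∈ Finset.range T, δ (s + 1) e₀ + d ≤ N.cap e₀) :
    N.IsDisturbance (strike δ T e₀ d) := by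
  have hnonneg (t e) : 0 ≤ strike δ T e₀ d (t + 1) e := (hδ.1 t e).trans (le_strike hd _ e)
  have hzero' (e : E) {t : ℕ} (ht : t ∉ Finset.range (T + 1)) :
      strike δ T e₀ d (t + 1) e = 0 := by
    rw [Finset.mem_range, not_lt] at ht
    rw [strike_of_ne (by lia), hzero t (by lia), Pi.zero_apply]
  refine ⟨hnonneg, fun t e => ?_⟩
  have hsum : HasSum (fun s => strike δ T e₀ d (s + 1) e)
      (∑ s ∈ Finset.range (T + 1), strike δ T e₀ d (s + 1) e) :=
    hasSum_sum_of_ne_finset_zero fun _ => hzero' e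
  refine (sum_le_hasSum (Finset.range t) (fun s _ => hnonneg s e) hsum).trans ?_
  by_cases he : e = e₀
  · subst he
    have hbefore : ∀ s ∈ Finset.range T, strike δ T e d (s + 1) e = δ (s + 1) e := fun s hs =>
      congrFun (strike_of_ne (Finset.mem_range.1 hs).ne) e
    rwa [Finset.sum_range_succ, Finset.sum_congr rfl hbefore, strike_self, hzero T le_rfl,
      Pi.zero_apply, zero_add]
  · simp only [strike_of_ne_link he]
    exact hδ.2 _ e

variable [Fintype E]

theorem disturbanceMagnitude_strike (hδ : N.IsDisturbance δ) (hd : 0 ≤ d) :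
    disturbanceMagnitude (strike δ T e₀ d) = disturbanceMagnitude δ + ENNReal.ofReal d := by
  have hterm (t : ℕ) (e : E) : ENNReal.ofReal (strike δ T e₀ d (t + 1) e) =
      ENNReal.ofReal (δ (t + 1) e) +
        if t = T then (if e = e₀ then ENNReal.ofReal d else 0) else 0 := by
    by_cases ht : t = T
    · by_cases he : e = e₀
      · rw [ht, he, strike_self, ENNReal.ofReal_add (hδ.1 T e₀) hd, if_pos rfl, if_pos rfl]
      · simp [strike_of_ne_link he, he]
    · simp [strike_of_ne ht, ht]
  simp only [disturbanceMagnitude, hterm, ENNReal.tsum_add, Finset.sum_add_distrib, tsum_ite_eq]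
  rw [Finset.sum_ite_eq' Finset.univ e₀, if_pos (Finset.mem_univ _)]

end Strike

section UpperBound

variable {n : ℕ} {E : Type*} [Fintype E] [DecidableEq E] {N : FlowNetwork n E} {lam : ℝ}
  {G : RoutingMap n E} {δ δ' : ℕ → E → ℝ} {T : ℕ}

theorem state_congr (h : ∀ t < T, δ' (t + 1) = δ (t + 1)) :
    N.state lam G δ' T = N.state lam G δ T := by
  induction T with
  | zero => rfl
  | succ T ih => simp only [state, ih fun t ht => h t (ht.trans T.lt_succ_self), h T T.lt_succ_self]

theorem links_state_succ_congr (h : ∀ t < T, δ' (t + 1) = δ (t + 1)) :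
    (N.state lam G δ' (T + 1)).links = (N.state lam G δ (T + 1)).links := by
  simp only [state, state_congr h, step]

theorem flow_state_succ_congr (h : ∀ t < T, δ' (t + 1) = δ (t + 1)) :
    (N.state lam G δ' (T + 1)).flow = (N.state lam G δ (T + 1)).flow := by
  simp only [state, state_congr h, step]

theorem IsDisturbance.rescap_le_cap (hδ : N.IsDisturbance δ) (t : ℕ) (e : E) :
    (N.state lam G δ t).rescap e ≤ N.cap e := by
  rw [rescap_state]
  exact sub_le_self _ (Finset.sum_nonneg fun s _ => hδ.1 s e)

/-- The disturbance `δ` has ended by time `T` and the dynamics has settled. -/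
structure IsQuietFrom (N : FlowNetwork n E) (lam : ℝ) (G : RoutingMap n E) (δ : ℕ → E → ℝ)
    (T : ℕ) : Prop where
  isDisturbance : N.IsDisturbance δ
  eq_zero : ∀ t ≥ T, δ (t + 1) = 0
  settled : N.SettledFrom lam G δ T

theorem exists_isQuietFrom_zero : ∃ T, N.IsQuietFrom lam G 0 T := by
  obtain ⟨T, -, hT⟩ := N.exists_settledFrom lam G 0 0
  exact ⟨T, ⟨fun _ _ => le_rfl, fun _ e => by simpa using (N.cap_pos e).le⟩, fun _ _ => rfl, hT⟩

theorem SettledFrom.notMem_links_strike (h : N.SettledFrom lam G δ T) (hδ : δ (T + 1) = 0) (e : E) :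
    e ∉ (N.state lam G (strike δ T e
      ((N.state lam G δ T).rescap e - (N.state lam G δ T).flow e)) (T + 2)).links := by
  intro hmem
  have hlt := (Finset.mem_filter.1 hmem).2.1
  have hbefore : ∀ t < T, strike δ T e
      ((N.state lam G δ T).rescap e - (N.state lam G δ T).flow e) (t + 1) = δ (t + 1) :=
    fun t ht => strike_of_ne ht.ne
  rw [flow_state_succ_congr hbefore, h.flow_eq _ T.le_succ, rescap_state,
    Finset.sum_range_succ, strike_self, hδ, Finset.sum_congr rfl fun s hs => congrFun
      (hbefore s (Finset.mem_range.1 hs)) e, rescap_state, Pi.zero_apply] at hlt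
  linarith

theorem IsQuietFrom.exists_strike (hG : N.IsRoutingPolicy G) (hlam : 0 ≤ lam)
    (h : N.IsQuietFrom lam G δ T) {e : E} (he : e ∈ (N.state lam G δ T).links) :
    ∃ δ' T', N.IsQuietFrom lam G δ' T' ∧
      disturbanceMagnitude δ' = disturbanceMagnitude δ + spareCap (N.state lam G δ T) e ∧
      (N.state lam G δ' T').links ⊆ (N.state lam G δ T).links ∧
      e ∉ (N.state lam G δ' T').links := by
  set d := (N.state lam G δ T).rescap e - (N.state lam G δ T).flow e with hd
  have hd₀ : 0 ≤ d := (sub_pos.2 (h.settled.isSettled.flow_lt e he)).le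
  have hcap : ∑ s ∈ Finset.range T, δ (s + 1) e + d ≤ N.cap e := by
    have hflow := hG.flow_nonneg hlam he
    rw [hd, rescap_state]
    linarith
  obtain ⟨T', hTT', hT'⟩ := N.exists_settledFrom lam G (strike δ T e d) (T + 2)
  have hanti := N.links_antitone lam G (strike δ T e d)
  refine ⟨strike δ T e d, T', ⟨isDisturbance_strike h.isDisturbance h.eq_zero hd₀ hcap,
    fun t ht => ?_, hT'⟩, disturbanceMagnitude_strike h.isDisturbance hd₀, ?_, fun he' => ?_⟩
  · rw [strike_of_ne (by lia), h.eq_zero t (by lia)]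
  · refine (hanti ((T + 1).le_succ.trans hTT')).trans ?_
    change (N.state lam G (strike δ T e d) (T + 1)).links ⊆ _
    rw [links_state_succ_congr fun t ht => strike_of_ne ht.ne, h.settled.links_eq _ T.le_succ]
  · exact h.settled.notMem_links_strike (h.eq_zero T le_rfl) e (hanti hTT' he')

variable (hG : N.IsRoutingPolicy G) (hU : ∀ v, N.IsUniformAt v) (huniq : N.HasUniqueInLinks)
  (hlam : 0 < lam)
include hG hU huniq hlam

theorem AttackPath.exists_not_isTransferring {e₀ : E} {b : ℝ≥0∞}
    (hpath : N.AttackPath lam (N.state lam G δ T) 0 e₀ b) (hδ : N.IsQuietFrom lam G δ T) :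
    ∃ δ', N.IsDisturbance δ' ∧ ¬ N.IsTransferring lam G δ' ∧
      disturbanceMagnitude δ' ≤
        disturbanceMagnitude δ + (spareCap (N.state lam G δ T) e₀ + b) := by
  induction hL : (N.state lam G δ T).links using Finset.strongInduction
    generalizing δ T e₀ b with
  | H L ih =>
    subst hL
    obtain ⟨δ', T', hδ', hmag, hsub, he₀⟩ := hδ.exists_strike hG hlam.le hpath.mem_links
    rw [← add_assoc, ← hmag]
    by_cases halive : (N.activeOut (N.state lam G δ' T') 0).Nonempty
    · obtain ⟨e₁, b', hpath', hb'⟩ := hpath.exists_next hG hU huniq hδ.settled.isSettled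
        hδ'.settled.isSettled (hδ'.isDisturbance.rescap_le_cap T') (hG.inflow_nonneg hlam.le T')
        hsub he₀ (by rw [inflow_zero, inflow_zero]) halive
      obtain ⟨δ'', hdist, hfail, hle⟩ := ih _
        (hsub.ssubset_of_not_subset fun h => he₀ (h hpath.mem_links)) hpath' hδ' rfl
      exact ⟨δ'', hdist, hfail, hle.trans (by gcongr)⟩
    · exact ⟨δ', hδ'.isDisturbance,
        fun htr => halive ((hG.isTransferring_iff hlam).1 htr T'), le_self_add⟩

theorem IsRoutingPolicy.resilience_le_bpaBound : N.resilience lam G ≤ N.bpaBound lam := by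
  suffices h : ∃ δ, N.IsDisturbance δ ∧ ¬ N.IsTransferring lam G δ ∧
      disturbanceMagnitude δ ≤ N.bpaBound lam by
    obtain ⟨δ, hδ, hfail, hle⟩ := h
    exact (iInf_le_of_le δ (iInf₂_le hδ hfail)).trans hle
  have hmag : disturbanceMagnitude (0 : ℕ → E → ℝ) = 0 := by simp [disturbanceMagnitude]
  obtain ⟨T, hT⟩ := exists_isQuietFrom_zero (N := N) (lam := lam) (G := G)
  by_cases halive : (N.activeOut (N.state lam G 0 T) 0).Nonempty
  · obtain ⟨e₀, b, hpath, hb⟩ := hT.settled.isSettled.exists_attackPath hG hU huniq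
      (hT.isDisturbance.rescap_le_cap T) (hG.inflow_nonneg hlam.le T) N.zero_ne_last halive
    obtain ⟨δ, hδ, hfail, hle⟩ := hpath.exists_not_isTransferring hG hU huniq hlam hT
    refine ⟨δ, hδ, hfail, ?_⟩
    calc disturbanceMagnitude δ
        ≤ spareCap (N.state lam G 0 T) e₀ + b := by rwa [hmag, zero_add] at hle
      _ ≤ cascadeSum (N.branchValue 0) (N.activeOut (N.state lam G 0 T) 0).card lam := by
        rwa [inflow_zero] at hb
      _ ≤ cascadeSum (N.branchValue 0) (N.outLinks 0).card lam :=
        cascadeSum_mono _ _ (Finset.card_le_card (activeOut_subset _ _))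
      _ = N.bpaBound lam := (nodeValue_eq_cascadeSum (hU 0)
        (strictAntiUntilZero_branchValue fun u _ => hU u).antitoneOn hlam.le N.zero_ne_last).symm
  · exact ⟨0, hT.isDisturbance, fun htr => halive ((hG.isTransferring_iff hlam).1 htr T),
      hmag.trans_le zero_le⟩

end UpperBound

section Resilience

variable {n : ℕ} {E : Type*} [DecidableEq E]

/-- The policy that splits every inflow evenly among the active links. -/
noncomputable def evenRouting (n : ℕ) (E : Type*) [DecidableEq E] : RoutingMap n E :=
  fun _ => evenSplit

variable [Fintype E] {N : FlowNetwork n E} {lam : ℝ} {G : RoutingMap n E}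

theorem isDistributedPolicy_evenRouting : N.IsDistributedPolicy (evenRouting n E) := by
  refine ⟨fun v _ J _ hJ μ hμ => ⟨evenSplit_nonneg hμ, fun e => evenSplit_of_notMem,
    sum_evenSplit hJ⟩, fun v _ J K _ hKJ hK μ hμ e he => ?_⟩
  simp only [evenRouting, evenSplit_of_mem he, evenSplit_of_mem (hKJ he)]
  exact div_card_le_div_card hμ hKJ hK

theorem isEvenWherePositive_evenRouting : N.IsEvenWherePositive (evenRouting n E) :=
  fun _ _ _ _ _ _ _ he => evenSplit_of_mem he

theorem IsEvenWherePositive.resilience_eq_bpaBound (hE : N.IsEvenWherePositive G)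
    (hG : N.IsRoutingPolicy G) (hU : ∀ v, N.IsUniformAt v) (huniq : N.HasUniqueInLinks)
    (hlam : 0 < lam) : N.resilience lam G = N.bpaBound lam :=
  le_antisymm (hG.resilience_le_bpaBound hU huniq hlam)
    (hE.bpaBound_le_resilience hG hU hlam huniq)

theorem maxResilience_eq_bpaBound (hU : ∀ v, N.IsUniformAt v) (huniq : N.HasUniqueInLinks)
    (hlam : 0 < lam) : N.maxResilience lam = N.bpaBound lam := by
  refine le_antisymm (iSup₂_le fun G hG => hG.1.resilience_le_bpaBound hU huniq hlam) ?_
  rw [← isEvenWherePositive_evenRouting.resilience_eq_bpaBound isDistributedPolicy_evenRouting.1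
    hU huniq hlam]
  exact le_iSup₂_of_le _ isDistributedPolicy_evenRouting le_rfl

end Resilience

end FlowNetwork

theorem proposition3_general {n : ℕ} {E : Type*} [Fintype E] [DecidableEq E] (N : FlowNetwork n E)
    (hTree : N.IsDirectedTree) (hU : ∀ v, N.IsUniformAt v) (lam : ℝ) (hlam : 0 < lam)
    (G : RoutingMap n E) (hG : N.IsRoutingPolicy G) (hE : N.IsEvenWherePositive G) :
    (∀ δ : ℕ → E → ℝ, N.IsDisturbance δ → disturbanceMagnitude δ < N.bpaBound lam →
      N.IsTransferring lam G δ) ∧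
    N.resilience lam G = N.maxResilience lam ∧
    ∀ G' : RoutingMap n E, N.IsRoutingPolicy G' → N.resilience lam G' ≤ N.resilience lam G := by
  have huniq : N.HasUniqueInLinks := hTree.hasUniqueInLinks
  have hres : N.resilience lam G = N.bpaBound lam := hE.resilience_eq_bpaBound hG hU huniq hlam
  refine ⟨fun δ => hE.isTransferring hG hU hlam huniq, ?_, fun G' hG' => ?_⟩
  · rw [hres, N.maxResilience_eq_bpaBound hU huniq hlam]
  · exact hres ▸ hG'.resilience_le_bpaBound hU huniq hlam

theorem proposition3 {n : ℕ} {E : Type*} [Fintype E] [DecidableEq E] (N : FlowNetwork n E)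
    (hTree : N.IsDirectedTree) (hSymm : N.IsSymmetric) (lam : ℝ) (hlam : 0 < lam)
    (G : RoutingMap n E) (hG : N.IsRoutingPolicy G) (hBPA : N.IsBPARouting G) :
    (∀ δ : ℕ → E → ℝ, N.IsDisturbance δ → disturbanceMagnitude δ < N.bpaBound lam →
      N.IsTransferring lam G δ) ∧
    N.resilience lam G = N.maxResilience lam := by
  have h := proposition3_general N hTree hSymm.isUniformAt lam hlam G hG
    (hBPA.isEvenWherePositive hSymm.isUniformAt)
  exact ⟨h.1, h.2.1⟩
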